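/- **Theorem (Chern–Weil).** Let $k\in\{\mathbb R,\mathbb C\}$, let $G\subset GL_n(k)$ be a matrix Lie group with Lie algebra $\mathfrak g=T_1G\subset \mathfrak{gl}_n(k)$, and let $M$ be a smooth finite-dimensional manifold (without boundary). Let $Q=(\{U_\alpha\},g_{\alpha\beta})$ be a principal $G$-bundle over $M$, given by an open cover $\{U_\alpha\}$ of $M$ and smooth transition functions $g_{\alpha\beta}\colon U_\alpha\cap U_\beta\to G$ with $g_{\alpha\alpha}=1$, $g_{\alpha\beta}=g_{\beta\alpha}^{-1}$ and $g_{\alpha\gamma}=g_{\beta\gamma}g_{\alpha\beta}$ on triple overlaps. A connection $A$ on $Q$ is a family of smooth $1$-forms $A_\alpha\in\Omega^1(U_\alpha,\mathfrak g)$ with $$A_\beta=g_{\alpha\beta}A_\alpha g_{\alpha\beta}^{-1}-(dg_{\alpha\beta})\,g_{\alpha\beta}^{-1}\quad\text{on }U_\alpha\cap U_\beta ,$$ and its curvature is given by $F(A)_\alpha=dA_\alpha+\tfrac12[A_\alpha,A_\alpha]\in\Omega^2(U_\alpha,\mathfrak g)$. Let $l\ge 0$ and let $P\colon\mathfrak g^{l}\to\mathbb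 C$ be an $\mathrm{Ad}$-invariant polynomial of degree $l$, that is, a symmetric real-multilinear map with $P(gX_1g^{-1},\dots,gX_lg^{-1})=P(X_1,\dots,X_l)$ for all $g\in G$ and $X_i\in\mathfrak g$. For $\mathfrak g$-valued forms $\omega_i=\sum_j\omega_i^{j}\otimes\xi_i^{j}$ put $P(\omega_1,\dots,\omega_l)=\sum_{j_1,\dots,j_l}\omega_1^{j_1}\wedge\dots\wedge\omega_l^{j_l}\,P(\xi_1^{j_1},\dots,\xi_l^{j_l})$, and $P(\omega)=P(\omega,\dots,\omega)$. 1. For every connection $A$ on $Q$ there is a unique global smooth form $P(F(A))\in\Omega^{2l}(M;\mathbb C)$ whose restriction to each $U_\alpha$ is $P(F(A)_\alpha)$. 2. This form is closed: $dP(F(A))=0$. 3. Let $A_0,A_1$ be connections on $Q$. If $l\ge1$, there is a global smooth form $\eta\in\Omega^{2l-1}(M;\mathbb C)$ with $$\eta|_{U_\alpha}=l\int_0^1P(F_{t,\alpha},\dots,F_{t,\alpha},B_\alpha)\,dt\quad\text{for all }\alpha,$$ where $P$ is evaluated on $l-1$ copies of $F_{t,\alpha}$, $B_\alpha=(A_1)_\alpha-(A_0)_\alpha$,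 and $F_{t,\alpha}$ is the curvature $dA_{t,\alpha}+\frac12[A_{t,\alpha},A_{t,\alpha}]$ of $A_{t,\alpha}=(A_0)_\alpha+tB_\alpha$, and it satisfies $$P(F(A_1))-P(F(A_0))=d\eta .$$ If $l=0$, then $P(F(A_1))=P(F(A_0))$. -/

import Mathlib

open scoped Manifold ContDiff Topology MatrixGroups

namespace ChernWeil

noncomputable section

/-! ### Matrix groups and their Lie algebras -/

/-- The underlying matrix of an element of a subgroup of `GL_n(𝕜)`. -/
abbrev toMat {n : ℕ} {𝕜 : Type*} [RCLike 𝕜] {G : Subgroup (GL (Fin n) 𝕜)} (g : G) :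
    Matrix (Fin n) (Fin n) 𝕜 :=
  ((g : GL (Fin n) 𝕜) : Matrix (Fin n) (Fin n) 𝕜)

@[simp] lemma toMat_one {n : ℕ} {𝕜 : Type*} [RCLike 𝕜] {G : Subgroup (GL (Fin n) 𝕜)} :
    toMat (1 : G) = 1 := rfl

@[simp] lemma toMat_mul {n : ℕ} {𝕜 : Type*} [RCLike 𝕜] {G : Subgroup (GL (Fin n) 𝕜)} (g h : G) :
    toMat (g * h) = toMat g * toMat h := rfl

/-- `X` is the velocity at `t = 0` of a smooth curve of matrices that runs in `G` and starts at
the identity. -/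
def IsTangentAtOne {n : ℕ} {𝕜 : Type*} [RCLike 𝕜] (G : Subgroup (GL (Fin n) 𝕜))
    (X : Matrix (Fin n) (Fin n) 𝕜) : Prop :=
  ∃ γ : ℝ → G, γ 0 = 1 ∧ (∀ i j, ContDiff ℝ ∞ fun t => toMat (γ t) i j) ∧
    ∀ i j, HasDerivAt (fun t => toMat (γ t) i j) (X i j) 0

/-- The Lie algebra `𝔤 ⊆ 𝔤𝔩_n(𝕜)` of the matrix group `G`: the tangent space at the identity, a
real vector space of matrices. -/
def matrixLieAlgebra {n : ℕ} {𝕜 : Type*} [RCLike 𝕜] (G : Subgroup (GL (Fin n) 𝕜)) :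
    Submodule ℝ (Matrix (Fin n) (Fin n) 𝕜) where
  carrier := {X | IsTangentAtOne G X}
  zero_mem' := ⟨fun _ => 1, rfl, fun _ _ => contDiff_const, fun i j => by
    simpa using hasDerivAt_const (0 : ℝ) _⟩
  add_mem' := by
    rintro X Y ⟨γ, hγ, hγs, hγd⟩ ⟨δ, hδ, hδs, hδd⟩
    refine ⟨fun t => γ t * δ t, by simp [hγ, hδ], fun i j => ?_, fun i j => ?_⟩
    · simp only [toMat_mul, Matrix.mul_apply]
      exact ContDiff.sum fun k _ => (hγs i k).mul (hδs k j)
    · simp only [toMat_mul, Matrix.mul_apply]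
      have := HasDerivAt.fun_sum (u := Finset.univ) fun k _ => (hγd i k).mul (hδd k j)
      have he : ∑ k, (X i k * toMat (δ 0) k j + toMat (γ 0) i k * Y k j) = (X + Y) i j := by
        simp [hγ, hδ, Matrix.one_apply, Finset.sum_add_distrib]
      rwa [he] at this
  smul_mem' := by
    rintro c X ⟨γ, hγ, hγs, hγd⟩
    refine ⟨fun t => γ (c * t), by simp [hγ], fun i j => ?_, fun i j => ?_⟩
    · exact (hγs i j).comp (contDiff_const.mul contDiff_id)
    · have h1 : HasDerivAt (fun t : ℝ => c * t) c 0 := by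
        simpa using (hasDerivAt_id (0 : ℝ)).const_mul c
      have h2 : HasDerivAt (fun t => toMat (γ t) i j) (X i j) (c * 0) := by
        simpa using hγd i j
      exact h2.scomp (0 : ℝ) h1

lemma isTangentAtOne_conj {n : ℕ} {𝕜 : Type*} [RCLike 𝕜] {G : Subgroup (GL (Fin n) 𝕜)} (g : G)
    {X : Matrix (Fin n) (Fin n) 𝕜} (hX : X ∈ matrixLieAlgebra G) :
    toMat g * X * toMat g⁻¹ ∈ matrixLieAlgebra G := by
  obtain ⟨γ, hγ, hγs, hγd⟩ := hX
  refine ⟨fun t => g * γ t * g⁻¹, by simp [hγ], fun i j => ?_, fun i j => ?_⟩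
  · simp only [toMat_mul, Matrix.mul_apply]
    exact ContDiff.sum fun k _ => (ContDiff.sum fun m _ =>
      contDiff_const.mul (hγs m k)).mul contDiff_const
  · simp only [toMat_mul, Matrix.mul_apply]
    exact HasDerivAt.fun_sum (u := Finset.univ) fun k _ => HasDerivAt.mul_const
      (HasDerivAt.fun_sum (u := Finset.univ) fun m _ => (hγd m k).const_mul _) _

lemma commutator_mem {n : ℕ} {𝕜 : Type*} [RCLike 𝕜] {G : Subgroup (GL (Fin n) 𝕜)}
    {X Y : Matrix (Fin n) (Fin n) 𝕜} (hX : X ∈ matrixLieAlgebra G)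
    (hY : Y ∈ matrixLieAlgebra G) : X * Y - Y * X ∈ matrixLieAlgebra G := by
  let : NormedAddCommGroup (Matrix (Fin n) (Fin n) 𝕜) := Matrix.normedAddCommGroup
  let : NormedSpace ℝ (Matrix (Fin n) (Fin n) 𝕜) := Matrix.normedSpace
  obtain ⟨γ, hγ, hγs, hγd⟩ := hX
  have hclosed : IsClosed (matrixLieAlgebra G : Set (Matrix (Fin n) (Fin n) 𝕜)) :=
    Submodule.closed_of_finiteDimensional _
  have hinv : Filter.Tendsto (fun t => toMat (γ t)⁻¹) (𝓝[≠] 0) (𝓝 1) := by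
    have hc : Continuous fun t => toMat (γ t) :=
      continuous_matrix fun i j => (hγs i j).continuous
    have hdet : ∀ t, (toMat (γ t)).det ≠ 0 := fun t =>
      ((Matrix.isUnit_iff_isUnit_det _).1 (Units.isUnit (γ t : GL (Fin n) 𝕜))).ne_zero
    have h : Continuous fun t => toMat (γ t)⁻¹ := by
      have he : (fun t => toMat (γ t)⁻¹) =
          fun t => (toMat (γ t)).det⁻¹ • (toMat (γ t)).adjugate := by
        funext t
        simp [toMat, Matrix.coe_units_inv, Matrix.inv_def]
      rw [he]
      exact (hc.matrix_det.inv₀ hdet).smul hc.matrix_adjugate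
    have h0 := (h.tendsto 0).mono_left (nhdsWithin_le_nhds (s := {0}ᶜ))
    simpa [hγ] using h0
  have hslope : Filter.Tendsto (fun t : ℝ => t⁻¹ • (toMat (γ t) - 1)) (𝓝[≠] 0) (𝓝 X) := by
    refine tendsto_pi_nhds.2 fun i => tendsto_pi_nhds.2 fun j => ?_
    have := (hγd i j).tendsto_slope_zero
    simpa [hγ, Matrix.one_apply] using this
  have hlim : Filter.Tendsto (fun t : ℝ => ((t⁻¹ • (toMat (γ t) - 1)) * Y
      - Y * (t⁻¹ • (toMat (γ t) - 1))) * toMat (γ t)⁻¹) (𝓝[≠] 0) (𝓝 ((X * Y - Y * X) * 1)) :=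
    ((hslope.mul tendsto_const_nhds).sub (tendsto_const_nhds.mul hslope)).mul hinv
  rw [mul_one] at hlim
  refine hclosed.mem_of_tendsto hlim (Filter.Eventually.of_forall fun t => ?_)
  have hg : toMat (γ t) * toMat (γ t)⁻¹ = 1 := by
    simp [toMat]
  have : ((t⁻¹ • (toMat (γ t) - 1)) * Y - Y * (t⁻¹ • (toMat (γ t) - 1))) * toMat (γ t)⁻¹
      = t⁻¹ • (toMat (γ t) * Y * toMat (γ t)⁻¹ - Y) := by
    rw [smul_mul_assoc, mul_smul_comm, ← smul_sub, smul_mul_assoc]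
    congr 1
    have : (toMat (γ t) - 1) * Y - Y * (toMat (γ t) - 1) = toMat (γ t) * Y - Y * toMat (γ t) := by
      noncomm_ring
    rw [this, sub_mul, mul_assoc Y, hg, mul_one]
  rw [SetLike.mem_coe, this]
  exact Submodule.smul_mem _ _ (Submodule.sub_mem _ (isTangentAtOne_conj _ hY) hY)

/-- The Lie algebra `𝔤` of `G` as a type. It carries the (entrywise maximum) norm of matrices; as
it is finite-dimensional, nothing below depends on the choice of a norm. -/
def LieAlg {n : ℕ} {𝕜 : Type*} [RCLike 𝕜] (G : Subgroup (GL (Fin n) 𝕜)) : Type _ :=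
  matrixLieAlgebra G

instance {n : ℕ} {𝕜 : Type*} [RCLike 𝕜] (G : Subgroup (GL (Fin n) 𝕜)) :
    NormedAddCommGroup (LieAlg G) :=
  letI : NormedAddCommGroup (Matrix (Fin n) (Fin n) 𝕜) := Matrix.normedAddCommGroup
  letI : NormedSpace ℝ (Matrix (Fin n) (Fin n) 𝕜) := Matrix.normedSpace
  inferInstanceAs (NormedAddCommGroup (matrixLieAlgebra G))

instance {n : ℕ} {𝕜 : Type*} [RCLike 𝕜] (G : Subgroup (GL (Fin n) 𝕜)) :
    NormedSpace ℝ (LieAlg G) :=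
  letI : NormedAddCommGroup (Matrix (Fin n) (Fin n) 𝕜) := Matrix.normedAddCommGroup
  letI : NormedSpace ℝ (Matrix (Fin n) (Fin n) 𝕜) := Matrix.normedSpace
  inferInstanceAs (NormedSpace ℝ (matrixLieAlgebra G))

/-- The inclusion `𝔤 ⊆ 𝔤𝔩_n(𝕜)`. -/
def LieAlg.val {n : ℕ} {𝕜 : Type*} [RCLike 𝕜] {G : Subgroup (GL (Fin n) 𝕜)} :
    LieAlg G →ₗ[ℝ] Matrix (Fin n) (Fin n) 𝕜 :=
  (matrixLieAlgebra G).subtype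

lemma LieAlg.val_injective {n : ℕ} {𝕜 : Type*} [RCLike 𝕜] {G : Subgroup (GL (Fin n) 𝕜)} :
    Function.Injective (LieAlg.val (G := G)) :=
  (matrixLieAlgebra G).injective_subtype

instance {n : ℕ} {𝕜 : Type*} [RCLike 𝕜] (G : Subgroup (GL (Fin n) 𝕜)) :
    FiniteDimensional ℝ (LieAlg G) :=
  FiniteDimensional.of_injective LieAlg.val LieAlg.val_injective

/-- The element of `𝔤` given by a matrix that is tangent to `G` at the identity. -/
def LieAlg.mk {n : ℕ} {𝕜 : Type*} [RCLike 𝕜] {G : Subgroup (GL (Fin n) 𝕜)}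
    (X : Matrix (Fin n) (Fin n) 𝕜) (hX : X ∈ matrixLieAlgebra G) : LieAlg G :=
  ⟨X, hX⟩

@[simp] lemma LieAlg.val_mk {n : ℕ} {𝕜 : Type*} [RCLike 𝕜] {G : Subgroup (GL (Fin n) 𝕜)}
    (X : Matrix (Fin n) (Fin n) 𝕜) (hX : X ∈ matrixLieAlgebra G) : (LieAlg.mk X hX).val = X := rfl

lemma LieAlg.val_mem {n : ℕ} {𝕜 : Type*} [RCLike 𝕜] {G : Subgroup (GL (Fin n) 𝕜)}
    (X : LieAlg G) : X.val ∈ matrixLieAlgebra G :=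
  Subtype.property (p := fun Y => Y ∈ matrixLieAlgebra G) X

/-- The adjoint action `X ↦ g X g⁻¹` of `G` on its Lie algebra. -/
def Ad {n : ℕ} {𝕜 : Type*} [RCLike 𝕜] {G : Subgroup (GL (Fin n) 𝕜)} (g : G)
    (X : LieAlg G) : LieAlg G :=
  LieAlg.mk (toMat g * X.val * toMat g⁻¹) (isTangentAtOne_conj g X.val_mem)

/-- The Lie bracket `[X, Y] = XY - YX` of `𝔤`, as a bilinear map of the pair `(X 0, X 1)`. -/
def lieBracket {n : ℕ} {𝕜 : Type*} [RCLike 𝕜] (G : Subgroup (GL (Fin n) 𝕜)) :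
    MultilinearMap ℝ (fun _ : Fin 2 => LieAlg G) (LieAlg G) :=
  LinearMap.uncurryLeft
    { toFun := fun X => MultilinearMap.ofSubsingleton ℝ _ _ (0 : Fin 1)
        { toFun := fun Y =>
            LieAlg.mk (X.val * Y.val - Y.val * X.val) (commutator_mem X.val_mem Y.val_mem)
          map_add' := fun Y Z => LieAlg.val_injective (by simp; noncomm_ring)
          map_smul' := fun c Y => LieAlg.val_injective (by simp [smul_sub]) }
      map_add' := fun X Z => by
        ext Y : 1
        exact LieAlg.val_injective (by simp; noncomm_ring)
      map_smul' := fun c X => by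
        ext Y : 1
        exact LieAlg.val_injective (by simp [smul_sub]) }

lemma val_lieBracket {n : ℕ} {𝕜 : Type*} [RCLike 𝕜] {G : Subgroup (GL (Fin n) 𝕜)}
    (X : Fin 2 → LieAlg G) :
    (lieBracket G X).val = (X 0).val * (X 1).val - (X 1).val * (X 0).val := rfl

/-- An `Ad`-invariant polynomial of degree `l` on `𝔤`: a symmetric real-multilinear map
`𝔤 × ⋯ × 𝔤 → ℂ` that is invariant under the adjoint action of `G`. -/
structure AdInvariantPolynomial {n : ℕ} {𝕜 : Type*} [RCLike 𝕜] (G : Subgroup (GL (Fin n) 𝕜))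
    (l : ℕ) where
  toMultilinearMap : MultilinearMap ℝ (fun _ : Fin l => LieAlg G) ℂ
  map_perm : ∀ (σ : Equiv.Perm (Fin l)) (X : Fin l → LieAlg G),
    toMultilinearMap (fun i => X (σ i)) = toMultilinearMap X
  map_ad : ∀ (g : G) (X : Fin l → LieAlg G),
    toMultilinearMap (fun i => Ad g (X i)) = toMultilinearMap X

/-! ### Differential forms on a manifold -/

/-- `V`-valued `k`-forms on the manifold `M` (modelled on `E`), no regularity imposed. -/
abbrev DiffForm (E : Type*) [NormedAddCommGroup E] [NormedSpace ℝ E] (M : Type*)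
    [TopologicalSpace M] [ChartedSpace E M] (k : ℕ) (V : Type*) [NormedAddCommGroup V]
    [NormedSpace ℝ V] :=
  (x : M) → TangentSpace 𝓘(ℝ, E) x [⋀^Fin k]→L[ℝ] V

/-- The expression of a form in the chart `e`: its pullback along `e⁻¹`, a form on `E`
(meaningful on `e.target`). -/
def DiffForm.inChart {E : Type*} [NormedAddCommGroup E] [NormedSpace ℝ E] {M : Type*}
    [TopologicalSpace M] [ChartedSpace E M] {k : ℕ} {V : Type*} [NormedAddCommGroup V]
    [NormedSpace ℝ V] (θ : DiffForm E M k V) (e : OpenPartialHomeomorph M E) (y : E) :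
    E [⋀^Fin k]→L[ℝ] V :=
  (θ (e.symm y)).compContinuousLinearMap ((mfderiv 𝓘(ℝ, E) 𝓘(ℝ, E) e.symm y).comp
    (NormedSpace.fromTangentSpace (𝕜 := ℝ) y).symm.toContinuousLinearMap)

/-- The form is smooth (`C^∞`) on the open set `s`: it is so in all charts of the atlas. -/
def DiffForm.SmoothOn {E : Type*} [NormedAddCommGroup E] [NormedSpace ℝ E] {M : Type*}
    [TopologicalSpace M] [ChartedSpace E M] {k : ℕ} {V : Type*} [NormedAddCommGroup V]
    [NormedSpace ℝ V] (θ : DiffForm E M k V) (s : Set M) : Prop :=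
  ∀ e ∈ atlas E M, ContDiffOn ℝ ∞ (θ.inChart e) (e.target ∩ e.symm ⁻¹' s)

/-- The exterior derivative: at `x`, the exterior derivative of the expression of the form in the
chart around `x`, pulled back to `M`. -/
def DiffForm.d {E : Type*} [NormedAddCommGroup E] [NormedSpace ℝ E] {M : Type*}
    [TopologicalSpace M] [ChartedSpace E M] {k : ℕ} {V : Type*} [NormedAddCommGroup V]
    [NormedSpace ℝ V] (θ : DiffForm E M k V) : DiffForm E M (k + 1) V := fun x =>
  (extDeriv (θ.inChart (chartAt E x)) (chartAt E x x)).compContinuousLinearMap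
    ((NormedSpace.fromTangentSpace (𝕜 := ℝ) (chartAt E x x)).toContinuousLinearMap.comp
      (mfderiv 𝓘(ℝ, E) 𝓘(ℝ, E) (chartAt E x) x))

/-- An alternating form of degree `k` regarded as one of degree `k'`, where `k = k'`. -/
def castAlternating {T V : Type*} [AddCommGroup T] [Module ℝ T] [TopologicalSpace T]
    [NormedAddCommGroup V] [NormedSpace ℝ V] {k k' : ℕ} (h : k = k') (a : T [⋀^Fin k]→L[ℝ] V) :
    T [⋀^Fin k']→L[ℝ] V where
  toContinuousMultilinearMap := a.toContinuousMultilinearMap.domDomCongr (finCongr h)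
  map_eq_zero_of_eq' := fun v i j hv hij => a.map_eq_zero_of_eq (fun m => v (finCongr h m))
    (i := (finCongr h).symm i) (j := (finCongr h).symm j) (by simpa using hv) (by simpa using hij)

/-- A `k`-form regarded as a `k'`-form, where `k = k'`. -/
def DiffForm.castDegree {E : Type*} [NormedAddCommGroup E] [NormedSpace ℝ E] {M : Type*}
    [TopologicalSpace M] [ChartedSpace E M] {k k' : ℕ} (h : k = k') {V : Type*}
    [NormedAddCommGroup V] [NormedSpace ℝ V] (θ : DiffForm E M k V) : DiffForm E M k' V :=
  fun x => castAlternating h (θ x)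

lemma continuous_multilinearMap {V W : Type*} [NormedAddCommGroup V] [NormedSpace ℝ V]
    [FiniteDimensional ℝ V] [NormedAddCommGroup W] [NormedSpace ℝ W] {l : ℕ}
    (μ : MultilinearMap ℝ (fun _ : Fin l => V) W) : Continuous μ := by
  let b := Module.finBasis ℝ V
  have h : ∀ X : Fin l → V, μ X = ∑ r : Fin l → Fin (Module.finrank ℝ V),
      (∏ i, b.repr (X i) (r i)) • μ fun i => b (r i) := fun X => by
    conv_lhs => rw [show X = fun i => ∑ j, b.repr (X i) j • b j from
      funext fun i => (b.sum_repr (X i)).symm]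
    rw [MultilinearMap.map_sum]
    exact Finset.sum_congr rfl fun r _ => μ.map_smul_univ _ _
  rw [show (μ : (Fin l → V) → W) = _ from funext h]
  refine continuous_finsetSum _ fun r _ => Continuous.smul ?_ continuous_const
  refine continuous_finsetProd _ fun i _ => ?_
  exact (LinearMap.continuous_of_finiteDimensional (b.coord (r i))).comp (continuous_apply i)

/-- The wedge product of alternating forms `θ i` of degree `k i` with values in `V`, combined by
the multilinear map `μ : V × ⋯ × V → W`. It is an alternating form of degree `N = ∑ i, k i`:
`(v₁, …, v_N) ↦ 1 / (k₁! ⋯ k_l!) * ∑ σ, sign σ • μ (θ₁ (v_σ(1), …, v_σ(k₁)), …)`, so for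
`θ i = ∑ j, a i j ⊗ ξ j` it is `∑ (a 1 j₁ ∧ ⋯ ∧ a l j_l) μ (ξ j₁, …, ξ j_l)`, where
`(a ∧ b) (v, w) = a v * b w - a w * b v` for `1`-forms. -/
def multiWedge {T V W : Type*} [AddCommGroup T] [Module ℝ T] [TopologicalSpace T]
    [NormedAddCommGroup V] [NormedSpace ℝ V] [FiniteDimensional ℝ V] [NormedAddCommGroup W]
    [NormedSpace ℝ W] {l : ℕ} (μ : MultilinearMap ℝ (fun _ : Fin l => V) W) {k : Fin l → ℕ}
    {N : ℕ} (hN : ∑ i, k i = N) (θ : (i : Fin l) → T [⋀^Fin (k i)]→L[ℝ] V) :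
    T [⋀^Fin N]→L[ℝ] W :=
  ((∏ i, (k i).factorial : ℕ) : ℝ)⁻¹ • ContinuousMultilinearMap.alternatization
    ({ toMultilinearMap :=
          (μ.compMultilinearMap fun i => (θ i).toContinuousMultilinearMap.toMultilinearMap).domDomCongr
            (finSigmaFinEquiv.trans (finCongr hN))
       cont := (continuous_multilinearMap μ).comp (continuous_pi fun i => (θ i).cont.comp
          (continuous_pi fun _ => continuous_apply _)) } :
      ContinuousMultilinearMap ℝ (fun _ : Fin N => T) W)

lemma multiWedge_apply {T V W : Type*} [AddCommGroup T] [Module ℝ T] [TopologicalSpace T]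
    [NormedAddCommGroup V] [NormedSpace ℝ V] [FiniteDimensional ℝ V] [NormedAddCommGroup W]
    [NormedSpace ℝ W] {l : ℕ} (μ : MultilinearMap ℝ (fun _ : Fin l => V) W) {k : Fin l → ℕ}
    {N : ℕ} (hN : ∑ i, k i = N) (θ : (i : Fin l) → T [⋀^Fin (k i)]→L[ℝ] V) (v : Fin N → T) :
    multiWedge μ hN θ v = ((∏ i, (k i).factorial : ℕ) : ℝ)⁻¹ •
      ∑ σ : Equiv.Perm (Fin N), Equiv.Perm.sign σ •
        μ fun i => θ i fun j => v (σ (finCongr hN (finSigmaFinEquiv ⟨i, j⟩))) := by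
  rw [multiWedge, ContinuousAlternatingMap.smul_apply,
    ContinuousMultilinearMap.alternatization_apply_apply]
  rfl

/-! ### Principal bundles with connection, over a trivializing cover -/

/-- A principal `G`-bundle over `M`, given by an open cover `U` and smooth transition functions
`g α β : U α ∩ U β → G` (their values elsewhere play no role). -/
structure PrincipalBundle {n : ℕ} {𝕜 : Type*} [RCLike 𝕜] (G : Subgroup (GL (Fin n) 𝕜))
    (E : Type*) [NormedAddCommGroup E] [NormedSpace ℝ E] (M : Type*) [TopologicalSpace M]
    [ChartedSpace E M] (ι : Type*) where
  U : ι → Set M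
  isOpen_U : ∀ α, IsOpen (U α)
  cover : ∀ x, ∃ α, x ∈ U α
  g : ι → ι → M → G
  smooth_g : ∀ α β i j,
    ContMDiffOn 𝓘(ℝ, E) 𝓘(ℝ, 𝕜) ∞ (fun x => toMat (g α β x) i j) (U α ∩ U β)
  g_self : ∀ α, ∀ x ∈ U α, g α α x = 1
  g_symm : ∀ α β, ∀ x ∈ U α ∩ U β, g α β x = (g β α x)⁻¹
  cocycle : ∀ α β γ, ∀ x ∈ U α ∩ U β ∩ U γ, g α γ x = g β γ x * g α β x

/-- The differential at `x`, in the direction `v`, of the matrix-valued function `g α β`. -/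
def PrincipalBundle.dg {n : ℕ} {𝕜 : Type*} [RCLike 𝕜] {G : Subgroup (GL (Fin n) 𝕜)}
    {E : Type*} [NormedAddCommGroup E] [NormedSpace ℝ E] {M : Type*} [TopologicalSpace M]
    [ChartedSpace E M] {ι : Type*} (Q : PrincipalBundle G E M ι) (α β : ι) (x : M)
    (v : TangentSpace 𝓘(ℝ, E) x) : Matrix (Fin n) (Fin n) 𝕜 :=
  Matrix.of fun i j => NormedSpace.fromTangentSpace (𝕜 := ℝ) _
    (mfderiv 𝓘(ℝ, E) 𝓘(ℝ, 𝕜) (fun y => toMat (Q.g α β y) i j) x v)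

/-- A connection on the bundle: smooth `𝔤`-valued `1`-forms `A α` on the sets `U α` (their values
elsewhere play no role) with `A β = g α β * A α * (g α β)⁻¹ - d(g α β) * (g α β)⁻¹` on
`U α ∩ U β`. -/
structure Connection {n : ℕ} {𝕜 : Type*} [RCLike 𝕜] {G : Subgroup (GL (Fin n) 𝕜)}
    {E : Type*} [NormedAddCommGroup E] [NormedSpace ℝ E] {M : Type*} [TopologicalSpace M]
    [ChartedSpace E M] {ι : Type*} (Q : PrincipalBundle G E M ι) where
  A : ι → DiffForm E M 1 (LieAlg G)
  smooth_A : ∀ α, (A α).SmoothOn (Q.U α)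
  transform : ∀ α β, ∀ x ∈ Q.U α ∩ Q.U β, ∀ v : TangentSpace 𝓘(ℝ, E) x,
    (A β x ![v]).val =
      toMat (Q.g α β x) * (A α x ![v]).val * toMat (Q.g α β x)⁻¹
        - Q.dg α β x v * toMat (Q.g α β x)⁻¹

/-- The bracket `[A, B]` of two `𝔤`-valued `1`-forms. -/
def bracketForm {n : ℕ} {𝕜 : Type*} [RCLike 𝕜] {G : Subgroup (GL (Fin n) 𝕜)}
    {E : Type*} [NormedAddCommGroup E] [NormedSpace ℝ E] {M : Type*} [TopologicalSpace M]
    [ChartedSpace E M] (A B : DiffForm E M 1 (LieAlg G)) :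
    DiffForm E M 2 (LieAlg G) := fun x =>
  multiWedge (lieBracket G) (k := fun _ => 1) (by simp) ![A x, B x]

/-- The curvature `F = dA + ½ [A, A]` of a local connection form. -/
def curvature {n : ℕ} {𝕜 : Type*} [RCLike 𝕜] {G : Subgroup (GL (Fin n) 𝕜)}
    {E : Type*} [NormedAddCommGroup E] [NormedSpace ℝ E] {M : Type*} [TopologicalSpace M]
    [ChartedSpace E M] (A : DiffForm E M 1 (LieAlg G)) :
    DiffForm E M 2 (LieAlg G) :=
  A.d + (1 / 2 : ℝ) • bracketForm A A

/-- The `2l`-form `P(F) = P(F, …, F)` of a `𝔤`-valued `2`-form `F`. -/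
def AdInvariantPolynomial.evalForm {n : ℕ} {𝕜 : Type*} [RCLike 𝕜]
    {G : Subgroup (GL (Fin n) 𝕜)} {E : Type*} [NormedAddCommGroup E] [NormedSpace ℝ E]
    {M : Type*} [TopologicalSpace M] [ChartedSpace E M] {l : ℕ} (P : AdInvariantPolynomial G l)
    (F : DiffForm E M 2 (LieAlg G)) : DiffForm E M (2 * l) ℂ := fun x =>
  multiWedge P.toMultilinearMap (k := fun _ => 2) (by simp [mul_comm]) fun _ => F x

lemma sum_degrees (l : ℕ) :
    ∑ i : Fin l, (if (i : ℕ) + 1 = l then 1 else 2) = 2 * l - 1 := by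
  cases l with
  | zero => rfl
  | succ m =>
    rw [Fin.sum_univ_castSucc, Finset.sum_congr rfl fun i _ => if_neg
      (show ¬ ((Fin.castSucc i : Fin (m + 1)) : ℕ) + 1 = m + 1 by have := i.2; simp; omega)]
    simp
    omega

/-- The `(2l-1)`-form `P(F, …, F, B)` of a `𝔤`-valued `2`-form `F`, in the first `l - 1` slots,
and a `𝔤`-valued `1`-form `B`, in the last slot. -/
def AdInvariantPolynomial.evalFormLast {n : ℕ} {𝕜 : Type*} [RCLike 𝕜]
    {G : Subgroup (GL (Fin n) 𝕜)} {E : Type*} [NormedAddCommGroup E] [NormedSpace ℝ E]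
    {M : Type*} [TopologicalSpace M] [ChartedSpace E M] {l : ℕ} (P : AdInvariantPolynomial G l)
    (F : DiffForm E M 2 (LieAlg G)) (B : DiffForm E M 1 (LieAlg G)) :
    DiffForm E M (2 * l - 1) ℂ := fun x =>
  multiWedge P.toMultilinearMap (sum_degrees l) fun i =>
    if h : (i : ℕ) + 1 = l then castAlternating (if_pos h).symm (B x)
    else castAlternating (if_neg h).symm (F x)

/-- `θ` is the global form `P(F)`: a smooth form on `M` that restricts on each `U α` to `P(F_α)`,
where `F_α` is the curvature of the connection form `A_α`. -/
def IsChernWeilForm {n : ℕ} {𝕜 : Type*} [RCLike 𝕜] {G : Subgroup (GL (Fin n) 𝕜)}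
    {E : Type*} [NormedAddCommGroup E] [NormedSpace ℝ E] {M : Type*} [TopologicalSpace M]
    [ChartedSpace E M] {ι : Type*} {Q : PrincipalBundle G E M ι} {l : ℕ}
    (P : AdInvariantPolynomial G l) (A : Connection Q) (θ : DiffForm E M (2 * l) ℂ) : Prop :=
  θ.SmoothOn Set.univ ∧ ∀ α, ∀ x ∈ Q.U α, θ x = P.evalForm (curvature (A.A α)) x

/-- `η` is the transgression form from `A₀` to `A₁`: a smooth form on `M` that restricts on each
`U α` to `l * ∫₀¹ P(F_t, …, F_t, B) dt`, where `B = A₁ - A₀` and `F_t` is the curvature of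
`A₀ + t B`. -/
def IsTransgressionForm {n : ℕ} {𝕜 : Type*} [RCLike 𝕜] {G : Subgroup (GL (Fin n) 𝕜)}
    {E : Type*} [NormedAddCommGroup E] [NormedSpace ℝ E] {M : Type*} [TopologicalSpace M]
    [ChartedSpace E M] {ι : Type*} {Q : PrincipalBundle G E M ι} {l : ℕ}
    (P : AdInvariantPolynomial G l) (A₀ A₁ : Connection Q) (η : DiffForm E M (2 * l - 1) ℂ) :
    Prop :=
  η.SmoothOn Set.univ ∧ ∀ α, ∀ x ∈ Q.U α, ∀ v : Fin (2 * l - 1) → TangentSpace 𝓘(ℝ, E) x,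
    η x v = (l : ℂ) * ∫ t in (0 : ℝ)..1,
      P.evalFormLast (curvature (A₀.A α + t • (A₁.A α - A₀.A α))) (A₁.A α - A₀.A α) x v

end

end ChernWeil

/-!
The proof is local: each assertion is checked in a chart of `M`, where a connection becomes a smooth
`𝔤`-valued `1`-form `a` on an open set of the vector space `E`, with curvature `F` (`localCurv`).
This is legitimate as the exterior derivative of `M` is computed by that of `E` in any chart
(`DiffForm.SmoothOn.inChart_d`, from the naturality of `extDeriv` under pullback).

*Global form.* A gauge transformation changes `F` by the adjoint action (`localCurv_gauge`), and `P`
is `Ad`-invariant, so the local forms `P(F)` agree on overlaps. The same holds for the transgression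
integrands, since a segment of connections consists of connections and the difference of two
connections transforms by the adjoint action.

*Closedness.* All wedge products are signed sums over permutations of the arguments (`altSum`), so
no sign of a shuffle has to be tracked: a signed sum does not change, up to the sign of the
permutation, when its summand is precomposed with a permutation. The Leibniz rule
(`extDeriv_multiWedge_apply`) writes `dP(F)` as the signed sum of the terms
`P(F, …, D_u F, …, F)`, with `u` the first argument. Differentiating the `Ad`-invariance of `P`
gives `∑ P(F, …, [a u, F], …, F) = 0` (`AdInvariantPolynomial.sum_update_bracketL`), so `D_u F` may
be replaced by the covariant derivative `∇_u F = D_u F + [a u, F]` (`extDeriv_invariant_apply`).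
By the Bianchi identity (`bianchi`), the cyclic sum of `∇_u F (v, w)` vanishes, and a signed sum whose
summand has vanishing cyclic sum over three of its arguments is zero (`altSum_eq_zero_of_cyclic`).

*Transgression.* Let `F` be the curvature of `a + t b`. The same argument shows that only
`P(F, …, F, ∇_u b)` survives in `dP(F, …, F, b)` (`extDeriv_evalPowLast`). On the other hand,
`dF/dt (u, v) = ∇_u b (v) - ∇_v b (u)` (`hasDerivAt_localCurv`), so that
`d/dt P(F) = l dP(F, …, F, b)` (`hasDerivAt_evalPow_localCurv`). Everything is polynomial in `t` with
smooth forms as coefficients (`IsPolyFamily`), so the exterior derivative commutes with the integral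
over `t` (`IsPolyFamily.exists_integral`), and the fundamental theorem of calculus gives the
transgression formula.
-/

namespace ChernWeil

/-! ### Signed sums over permutations -/

/-- The signed sum `∑ σ, sign σ • H (v ∘ σ)` of a function `H` of `K` arguments, which need not be
multilinear. -/
noncomputable def altSum {T W : Type*} [AddCommGroup W] {K : ℕ} (H : (Fin K → T) → W)
    (v : Fin K → T) : W :=
  ∑ σ : Equiv.Perm (Fin K), Equiv.Perm.sign σ • H (v ∘ σ)

section altSum

variable {T W : Type*} [AddCommGroup W] {K : ℕ}

lemma altSum_add (H H' : (Fin K → T) → W) (v : Fin K → T) :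
    altSum (fun w => H w + H' w) v = altSum H v + altSum H' v := by
  simp [altSum, Finset.sum_add_distrib]

lemma altSum_sub (H H' : (Fin K → T) → W) (v : Fin K → T) :
    altSum (fun w => H w - H' w) v = altSum H v - altSum H' v := by
  simp [altSum, smul_sub, Finset.sum_sub_distrib]

lemma altSum_sum {ι : Type*} (s : Finset ι) (H : ι → (Fin K → T) → W) (v : Fin K → T) :
    altSum (fun w => ∑ i ∈ s, H i w) v = ∑ i ∈ s, altSum (H i) v := by
  simp only [altSum, Finset.smul_sum]
  exact Finset.sum_comm

lemma altSum_comp_perm (H : (Fin K → T) → W) (ρ : Equiv.Perm (Fin K)) (v : Fin K → T) :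
    altSum (fun w => H (w ∘ ρ)) v = Equiv.Perm.sign ρ • altSum H v := by
  rw [altSum, altSum, Finset.smul_sum]
  refine Fintype.sum_equiv (Equiv.mulRight ρ) _ _ fun σ => ?_
  rw [Equiv.coe_mulRight, Equiv.Perm.sign_mul, ← mul_smul, mul_comm (Equiv.Perm.sign σ), ← mul_assoc,
    Int.units_mul_self, one_mul, Equiv.Perm.coe_mul]
  rfl

/-- A function whose cyclic sum over three of its arguments vanishes has signed sum zero. -/
lemma altSum_eq_zero_of_cyclic [Module ℝ W] (H : (Fin K → T) → W) {p q r : Fin K} (hpq : p ≠ q)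
    (hqr : q ≠ r) (hpr : p ≠ r)
    (hH : ∀ w, H w + H (w ∘ (Equiv.swap p q * Equiv.swap q r : Equiv.Perm (Fin K)))
      + H (w ∘ (Equiv.swap p r * Equiv.swap r q : Equiv.Perm (Fin K))) = 0) (v : Fin K → T) :
    altSum H v = 0 := by
  have h : altSum (fun w => H w + H (w ∘ (Equiv.swap p q * Equiv.swap q r : Equiv.Perm (Fin K)))
      + H (w ∘ (Equiv.swap p r * Equiv.swap r q : Equiv.Perm (Fin K)))) v = 0 := by
    simp only [hH, altSum, smul_zero, Finset.sum_const_zero]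
  rw [altSum_add, altSum_add, altSum_comp_perm, altSum_comp_perm] at h
  simp only [Equiv.Perm.sign_mul, Equiv.Perm.sign_swap hpq, Equiv.Perm.sign_swap hqr,
    Equiv.Perm.sign_swap hpr, Equiv.Perm.sign_swap hqr.symm, Int.units_mul_self, one_smul] at h
  have h3 : (3 : ℝ) • altSum H v = 0 := by
    rw [← h, show (3 : ℝ) = 1 + 1 + 1 by norm_num, add_smul, add_smul, one_smul]
  exact (smul_eq_zero.1 h3).resolve_left (by norm_num)

/-- Expansion of a signed sum over permutations of `K + 1` letters by the image of the first
letter. -/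
lemma altSum_succ (H : T → (Fin K → T) → W) (v : Fin (K + 1) → T) :
    altSum (fun w => H (w 0) fun j => w j.succ) v =
      ∑ i : Fin (K + 1), (-1) ^ (i : ℕ) • altSum (H (v i)) (i.removeNth v) := by
  let f : Fin (K + 1) × Equiv.Perm (Fin K) → Equiv.Perm (Fin (K + 1)) := fun x =>
    x.1.cycleRange.symm * Equiv.Perm.decomposeFin.symm (0, x.2)
  have h0 : ∀ x, f x 0 = x.1 := fun x => by simp [f, Fin.cycleRange_symm_zero]
  have hs : ∀ x j, f x (Fin.succ j) = x.1.succAbove (x.2 j) := fun x j => by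
    simp [f, Fin.cycleRange_symm_succ]
  have hinj : Function.Injective f := by
    intro x y hxy
    have h1 : x.1 = y.1 := by rw [← h0 x, ← h0 y, hxy]
    refine Prod.ext h1 (Equiv.ext fun j => ?_)
    have := hs x j
    rw [hxy, hs y j, h1] at this
    exact (Fin.succAbove_right_injective this).symm
  have hbij : Function.Bijective f := by
    rw [Fintype.bijective_iff_injective_and_card]
    refine ⟨hinj, ?_⟩
    simp [Fintype.card_perm, Nat.factorial_succ]
  have hsign : ∀ x, Equiv.Perm.sign (f x) = (-1) ^ (x.1 : ℕ) * Equiv.Perm.sign x.2 := fun x => by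
    simp only [f, Equiv.Perm.sign_mul, Equiv.Perm.sign_symm, Fin.sign_cycleRange,
      Equiv.Perm.decomposeFin.symm_sign, if_true, one_mul]
  rw [altSum, ← Fintype.sum_equiv (Equiv.ofBijective f hbij) (fun x => (-1) ^ (x.1 : ℕ) •
    Equiv.Perm.sign x.2 • H (v x.1) (x.1.removeNth v ∘ x.2)) _ ?_, Fintype.sum_prod_type]
  · simp only [altSum, Finset.smul_sum]
  · intro x
    simp only [Equiv.ofBijective_apply, Function.comp_apply, hsign, h0, hs, mul_smul]
    rcases Nat.even_or_odd (x.1 : ℕ) with h | h <;> simp [h] <;> rfl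

end altSum

/-! ### The wedge product as a function of its factors -/

section multiWedge

variable {T V W : Type*} [NormedAddCommGroup V] [NormedSpace ℝ V] [FiniteDimensional ℝ V]
  [NormedAddCommGroup W] [NormedSpace ℝ W] {l : ℕ} {k : Fin l → ℕ} {N : ℕ}

/-- The position, among the `N` arguments of a wedge product, of the `j`-th argument of the `i`-th
factor. -/
def slot (hN : ∑ i, k i = N) (i : Fin l) (j : Fin (k i)) : Fin N :=
  finCongr hN (finSigmaFinEquiv ⟨i, j⟩)

lemma slot_injective (hN : ∑ i, k i = N) {i i' : Fin l} {j : Fin (k i)} {j' : Fin (k i')}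
    (h : slot hN i j = slot hN i' j') : (⟨i, j⟩ : (i : Fin l) × Fin (k i)) = ⟨i', j'⟩ :=
  finSigmaFinEquiv.injective ((finCongr hN).injective h)

lemma multiWedge_eq_altSum [AddCommGroup T] [Module ℝ T] [TopologicalSpace T]
    (μ : MultilinearMap ℝ (fun _ : Fin l => V) W) (hN : ∑ i, k i = N)
    (θ : (i : Fin l) → T [⋀^Fin (k i)]→L[ℝ] V) (v : Fin N → T) :
    multiWedge μ hN θ v = ((∏ i, (k i).factorial : ℕ) : ℝ)⁻¹ •
      altSum (fun w => μ fun i => θ i fun j => w (slot hN i j)) v :=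
  multiWedge_apply μ hN θ v

lemma multiWedge_comp {T' : Type*} [AddCommGroup T] [Module ℝ T] [TopologicalSpace T]
    [AddCommGroup T'] [Module ℝ T'] [TopologicalSpace T']
    (μ : MultilinearMap ℝ (fun _ : Fin l => V) W) (hN : ∑ i, k i = N)
    (θ : (i : Fin l) → T [⋀^Fin (k i)]→L[ℝ] V) (f : T' →L[ℝ] T) :
    (multiWedge μ hN θ).compContinuousLinearMap f =
      multiWedge μ hN fun i => (θ i).compContinuousLinearMap f := by
  ext v
  simp only [ContinuousAlternatingMap.compContinuousLinearMap_apply, multiWedge_eq_altSum]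
  rfl

variable [NormedAddCommGroup T] [NormedSpace ℝ T]

lemma exists_multiWedge_bound (μ : MultilinearMap ℝ (fun _ : Fin l => V) W) (hN : ∑ i, k i = N) :
    ∃ C, ∀ θ : (i : Fin l) → T [⋀^Fin (k i)]→L[ℝ] V, ‖multiWedge μ hN θ‖ ≤ C * ∏ i, ‖θ i‖ := by
  obtain ⟨C, hC, hμ⟩ := μ.exists_bound_of_continuous (continuous_multilinearMap μ)
  refine ⟨((∏ i, (k i).factorial : ℕ) : ℝ)⁻¹ * ((Fintype.card (Equiv.Perm (Fin N)) : ℕ) * C),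
    fun θ => ContinuousAlternatingMap.opNorm_le_bound _ (by positivity) fun v => ?_⟩
  rw [multiWedge_eq_altSum, norm_smul, norm_inv, Real.norm_natCast, mul_assoc, mul_assoc]
  refine mul_le_mul_of_nonneg_left ?_ (by positivity)
  have h : ∀ σ : Equiv.Perm (Fin N), ‖Equiv.Perm.sign σ •
      μ fun i => θ i fun j => (v ∘ σ) (slot hN i j)‖ ≤ C * (∏ i, ‖θ i‖) * ∏ m, ‖v m‖ := by
    intro σ
    have h1 : ‖Equiv.Perm.sign σ • μ fun i => θ i fun j => (v ∘ σ) (slot hN i j)‖ =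
        ‖μ fun i => θ i fun j => (v ∘ σ) (slot hN i j)‖ := by
      rcases Int.units_eq_one_or (Equiv.Perm.sign σ) with h | h <;> simp [h]
    rw [h1]
    refine (hμ _).trans ?_
    rw [mul_assoc]
    refine mul_le_mul_of_nonneg_left ?_ hC.le
    calc ∏ i, ‖θ i fun j => (v ∘ σ) (slot hN i j)‖
        ≤ ∏ i, (‖θ i‖ * ∏ j, ‖v (σ (slot hN i j))‖) :=
          Finset.prod_le_prod (fun _ _ => norm_nonneg _) fun i _ => (θ i).le_opNorm _
      _ = (∏ i, ‖θ i‖) * ∏ m, ‖v m‖ := by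
          rw [Finset.prod_mul_distrib, ← Equiv.prod_comp σ, ← Equiv.prod_comp
            (finSigmaFinEquiv.trans (finCongr hN)), Fintype.prod_sigma]
          rfl
  refine (norm_sum_le _ _).trans ((Finset.sum_le_sum fun σ _ => h σ).trans (le_of_eq ?_))
  rw [Finset.sum_const, Finset.card_univ, nsmul_eq_mul]
  ring

/-- The wedge product as a continuous multilinear map of its factors. -/
noncomputable def multiWedgeCMM (T : Type*) [NormedAddCommGroup T] [NormedSpace ℝ T]
    (μ : MultilinearMap ℝ (fun _ : Fin l => V) W) (hN : ∑ i, k i = N) :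
    ContinuousMultilinearMap ℝ (fun i : Fin l => T [⋀^Fin (k i)]→L[ℝ] V) (T [⋀^Fin N]→L[ℝ] W) :=
  MultilinearMap.mkContinuous
    { toFun := fun θ => multiWedge μ hN θ
      map_update_add' := fun θ i a b => by
        ext v
        have h : ∀ (c : T [⋀^Fin (k i)]→L[ℝ] V) (w : Fin N → T),
            (fun i' => Function.update θ i c i' fun j => w (slot hN i' j)) =
            Function.update (fun i' => θ i' fun j => w (slot hN i' j)) i
              (c fun j => w (slot hN i j)) := fun c w => by
          ext i'
          rcases eq_or_ne i' i with rfl | hi <;> simp [*]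
        -- The field quantifies over the decidability instance in `Function.update`.
        rename_i inst
        obtain rfl : inst = instDecidableEqFin l := Subsingleton.elim _ _
        simp only [ContinuousAlternatingMap.add_apply, multiWedge_eq_altSum, h,
          MultilinearMap.map_update_add, altSum_add, smul_add]
      map_update_smul' := fun θ i c a => by
        ext v
        have h : ∀ (c : T [⋀^Fin (k i)]→L[ℝ] V) (w : Fin N → T),
            (fun i' => Function.update θ i c i' fun j => w (slot hN i' j)) =
            Function.update (fun i' => θ i' fun j => w (slot hN i' j)) i
              (c fun j => w (slot hN i j)) := fun c w => by
          ext i'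
          rcases eq_or_ne i' i with rfl | hi <;> simp [*]
        -- The field quantifies over the decidability instance in `Function.update`.
        rename_i inst
        obtain rfl : inst = instDecidableEqFin l := Subsingleton.elim _ _
        simp only [ContinuousAlternatingMap.smul_apply, multiWedge_eq_altSum, h,
          MultilinearMap.map_update_smul]
        rw [smul_comm]
        congr 1
        simp only [altSum, Finset.smul_sum]
        exact Finset.sum_congr rfl fun σ _ => smul_comm _ _ _ }
    (exists_multiWedge_bound (T := T) μ hN).choose (exists_multiWedge_bound μ hN).choose_spec

lemma multiWedgeCMM_apply (μ : MultilinearMap ℝ (fun _ : Fin l => V) W) (hN : ∑ i, k i = N)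
    (θ : (i : Fin l) → T [⋀^Fin (k i)]→L[ℝ] V) : multiWedgeCMM T μ hN θ = multiWedge μ hN θ :=
  rfl

lemma _root_.ContDiffOn.multiWedge {X : Type*} [NormedAddCommGroup X] [NormedSpace ℝ X]
    (μ : MultilinearMap ℝ (fun _ : Fin l => V) W) (hN : ∑ i, k i = N) {s : Set X}
    {θ : (i : Fin l) → X → T [⋀^Fin (k i)]→L[ℝ] V} (hθ : ∀ i, ContDiffOn ℝ ∞ (θ i) s) :
    ContDiffOn ℝ ∞ (fun y => ChernWeil.multiWedge μ hN fun i => θ i y) s :=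
  (multiWedgeCMM T μ hN).contDiff.comp_contDiffOn (contDiffOn_pi.2 hθ)

lemma multiWedge_update_apply (μ : MultilinearMap ℝ (fun _ : Fin l => V) W) (hN : ∑ i, k i = N)
    (θ : (i : Fin l) → T [⋀^Fin (k i)]→L[ℝ] V) (i : Fin l) (c : T [⋀^Fin (k i)]→L[ℝ] V)
    (v : Fin N → T) :
    multiWedge μ hN (Function.update θ i c) v = ((∏ i, (k i).factorial : ℕ) : ℝ)⁻¹ •
      altSum (fun w => μ (Function.update (fun i' => θ i' fun j => w (slot hN i' j)) i
        (c fun j => w (slot hN i j)))) v := by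
  rw [multiWedge_eq_altSum]
  congr 2
  funext w
  congr 1
  ext i'
  rcases eq_or_ne i' i with rfl | hi <;> simp [*]

lemma hasFDerivAt_multiWedge {X : Type*} [NormedAddCommGroup X] [NormedSpace ℝ X]
    (μ : MultilinearMap ℝ (fun _ : Fin l => V) W) (hN : ∑ i, k i = N)
    {θ : (i : Fin l) → X → T [⋀^Fin (k i)]→L[ℝ] V} {y : X}
    {θ' : (i : Fin l) → X →L[ℝ] T [⋀^Fin (k i)]→L[ℝ] V}
    (hθ : ∀ i, HasFDerivAt (θ i) (θ' i) y) :
    HasFDerivAt (fun y => multiWedge μ hN fun i => θ i y)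
      (((multiWedgeCMM T μ hN).linearDeriv fun i => θ i y).comp (ContinuousLinearMap.pi θ')) y :=
  HasFDerivAt.comp (g := multiWedgeCMM T μ hN) (f := fun x i => θ i x) y
    ((multiWedgeCMM T μ hN).hasFDerivAt fun i => θ i y) (hasFDerivAt_pi.2 hθ)

lemma linearDeriv_multiWedgeCMM_apply (μ : MultilinearMap ℝ (fun _ : Fin l => V) W)
    (hN : ∑ i, k i = N) (θ θ' : (i : Fin l) → T [⋀^Fin (k i)]→L[ℝ] V) (v : Fin N → T) :
    (multiWedgeCMM T μ hN).linearDeriv θ θ' v = ((∏ i, (k i).factorial : ℕ) : ℝ)⁻¹ •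
      altSum (fun w => ∑ i, μ (Function.update (fun i' => θ i' fun j => w (slot hN i' j)) i
        (θ' i fun j => w (slot hN i j)))) v := by
  rw [ContinuousMultilinearMap.linearDeriv_apply, ContinuousAlternatingMap.sum_apply,
    altSum_sum, Finset.smul_sum]
  refine Finset.sum_congr rfl fun i _ => ?_
  rw [multiWedgeCMM_apply, multiWedge_update_apply]

/-- The Leibniz rule, before the sorting of arguments: the exterior derivative of a wedge product is
a signed sum of all the terms in which one factor is differentiated in the direction of the first
argument. -/
lemma extDeriv_multiWedge_apply (μ : MultilinearMap ℝ (fun _ : Fin l => V) W)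
    (hN : ∑ i, k i = N) {θ : (i : Fin l) → T → T [⋀^Fin (k i)]→L[ℝ] V} {y : T}
    (hθ : ∀ i, DifferentiableAt ℝ (θ i) y) (v : Fin (N + 1) → T) :
    extDeriv (fun y => multiWedge μ hN fun i => θ i y) y v =
      ((∏ i, (k i).factorial : ℕ) : ℝ)⁻¹ • altSum (fun w => ∑ i,
        μ (Function.update (fun i' => θ i' y fun j => w (slot hN i' j).succ) i
          (fderiv ℝ (θ i) y (w 0) fun j => w (slot hN i j).succ))) v := by
  rw [extDeriv, (hasFDerivAt_multiWedge μ hN fun i => (hθ i).hasFDerivAt).fderiv,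
    ContinuousAlternatingMap.alternatizeUncurryFin_apply, altSum_succ (fun u w => ∑ i,
        μ (Function.update (fun i' => θ i' y fun j => w (slot hN i' j)) i
          (fderiv ℝ (θ i) y u fun j => w (slot hN i j)))), Finset.smul_sum]
  refine Finset.sum_congr rfl fun i _ => ?_
  rw [ContinuousLinearMap.comp_apply, linearDeriv_multiWedgeCMM_apply, smul_comm]
  rfl

end multiWedge

/-! ### Forms depending polynomially on a parameter -/

/-- `φ t y` depends polynomially on `t`, with coefficients that are smooth functions of `y ∈ s`. -/
def IsPolyFamily {X Y : Type*} [NormedAddCommGroup X] [NormedSpace ℝ X] [NormedAddCommGroup Y]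
    [NormedSpace ℝ Y] (s : Set X) (φ : ℝ → X → Y) : Prop :=
  ∃ (J : Type) (_ : Fintype J) (d : J → ℕ) (c : J → X → Y), (∀ j, ContDiffOn ℝ ∞ (c j) s) ∧
    ∀ t, ∀ y ∈ s, φ t y = ∑ j, t ^ d j • c j y

namespace IsPolyFamily

variable {X Y : Type*} [NormedAddCommGroup X] [NormedSpace ℝ X] [NormedAddCommGroup Y]
    [NormedSpace ℝ Y] {s : Set X} {φ : ℝ → X → Y}

lemma const {c : X → Y} (hc : ContDiffOn ℝ ∞ c s) : IsPolyFamily s fun _ => c :=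
  ⟨Unit, inferInstance, fun _ => 0, fun _ => c, fun _ => hc, by simp⟩

lemma multiWedge {T V W : Type*} [NormedAddCommGroup V] [NormedSpace ℝ V] [FiniteDimensional ℝ V]
    [NormedAddCommGroup W] [NormedSpace ℝ W] [NormedAddCommGroup T] [NormedSpace ℝ T]
    {l : ℕ} {k : Fin l → ℕ} {N : ℕ} (μ : MultilinearMap ℝ (fun _ : Fin l => V) W)
    (hN : ∑ i, k i = N) {θ : (i : Fin l) → ℝ → X → T [⋀^Fin (k i)]→L[ℝ] V}
    (hθ : ∀ i, IsPolyFamily s (θ i)) :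
    IsPolyFamily s fun t y => ChernWeil.multiWedge μ hN fun i => θ i t y := by
  choose J hJ d c hc h using hθ
  refine ⟨∀ i, J i, inferInstance, fun r => ∑ i, d i (r i),
    fun r y => ChernWeil.multiWedge μ hN fun i => c i (r i) y,
    fun r => .multiWedge μ hN fun i => hc i (r i), fun t y hy => ?_⟩
  simp only [h _ t y hy, ← multiWedgeCMM_apply]
  rw [ContinuousMultilinearMap.map_sum]
  refine Finset.sum_congr rfl fun r _ => ?_
  rw [ContinuousMultilinearMap.map_smul_univ, Finset.prod_pow_eq_pow_sum]

lemma add {φ' : ℝ → X → Y} (h : IsPolyFamily s φ) (h' : IsPolyFamily s φ') :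
    IsPolyFamily s fun t => φ t + φ' t := by
  obtain ⟨J, _, d, c, hc, h⟩ := h
  obtain ⟨J', _, d', c', hc', h'⟩ := h'
  refine ⟨J ⊕ J', inferInstance, Sum.elim d d', Sum.elim c c', fun j => ?_, fun t y hy => ?_⟩
  · rcases j with j | j
    · exact hc j
    · exact hc' j
  · simp [h t y hy, h' t y hy]

lemma const_smul (r : ℝ) (h : IsPolyFamily s φ) : IsPolyFamily s fun t => r • φ t := by
  obtain ⟨J, _, d, c, hc, h⟩ := h
  refine ⟨J, inferInstance, d, fun j y => r • c j y, fun j => (hc j).const_smul r,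
    fun t y hy => ?_⟩
  simp only [Pi.smul_apply, h t y hy, Finset.smul_sum, smul_comm r]

lemma smul_param (h : IsPolyFamily s φ) : IsPolyFamily s fun t => t • φ t := by
  obtain ⟨J, _, d, c, hc, h⟩ := h
  refine ⟨J, inferInstance, fun j => d j + 1, c, hc, fun t y hy => ?_⟩
  simp only [Pi.smul_apply, h t y hy, Finset.smul_sum, smul_smul, pow_succ']

lemma extDeriv_sum_smul {J : Type*} [Fintype J] {k : ℕ} {c : J → X → X [⋀^Fin k]→L[ℝ] Y} {y : X}
    (hc : ∀ j, DifferentiableAt ℝ (c j) y) (r : J → ℝ) :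
    extDeriv (fun y => ∑ j, r j • c j y) y = ∑ j, r j • extDeriv (c j) y := by
  have hd : ∀ j, HasFDerivAt (fun y => r j • c j y) (r j • fderiv ℝ (c j) y) y := fun j =>
    (hc j).hasFDerivAt.const_smul (r j)
  rw [extDeriv, (HasFDerivAt.fun_sum fun j _ => hd j).fderiv]
  ext v
  simp only [ContinuousAlternatingMap.alternatizeUncurryFin_apply, extDeriv,
    sum_apply, ContinuousAlternatingMap.sum_apply, Finset.smul_sum,
    smul_apply, ContinuousAlternatingMap.smul_apply]
  rw [Finset.sum_comm]
  exact Finset.sum_congr rfl fun j _ => Finset.sum_congr rfl fun i _ => smul_comm _ _ _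

lemma exteriorDeriv {k : ℕ} {φ : ℝ → X → X [⋀^Fin k]→L[ℝ] Y} (hs : IsOpen s)
    (h : IsPolyFamily s φ) : IsPolyFamily s fun t => extDeriv (φ t) := by
  obtain ⟨J, _, d, c, hc, h⟩ := h
  refine ⟨J, inferInstance, d, fun j => extDeriv (c j), fun j => ?_, fun t y hy => ?_⟩
  · exact (ContinuousAlternatingMap.alternatizeUncurryFinCLM ℝ X Y).contDiff.comp_contDiffOn
      ((hc j).fderiv_of_isOpen (m := ∞) hs (by simp))
  · rw [← extDeriv_sum_smul fun j => ((hc j).contDiffAt (hs.mem_nhds hy)).differentiableAt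
      (by simp : (∞ : WithTop ℕ∞) ≠ 0)]
    refine Filter.EventuallyEq.extDeriv_eq ?_
    filter_upwards [hs.mem_nhds hy] with z hz using h t z hz

/-- Integration over the parameter of a polynomial family of forms: the integral is smooth, and
commutes with the exterior derivative. -/
lemma exists_integral {k : ℕ} {φ : ℝ → X → X [⋀^Fin k]→L[ℝ] Y} [CompleteSpace Y] (hs : IsOpen s)
    (h : IsPolyFamily s φ) :
    ∃ η : X → X [⋀^Fin k]→L[ℝ] Y, ContDiffOn ℝ ∞ η s ∧
      (∀ y ∈ s, ∀ v, η y v = ∫ t in (0 : ℝ)..1, φ t y v) ∧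
      ∀ y ∈ s, ∀ v, Continuous (fun t => extDeriv (φ t) y v) ∧
        extDeriv η y v = ∫ t in (0 : ℝ)..1, extDeriv (φ t) y v := by
  obtain ⟨J, _, d, c, hc, h⟩ := h
  have key : ∀ a : J → Y, ∑ j, ((d j : ℝ) + 1)⁻¹ • a j =
      ∫ t in (0 : ℝ)..1, ∑ j, t ^ d j • a j := fun a => by
    rw [intervalIntegral.integral_finsetSum fun j _ =>
      (by fun_prop : Continuous fun t : ℝ => t ^ d j • a j).intervalIntegrable _ _]
    refine Finset.sum_congr rfl fun j _ => ?_
    rw [intervalIntegral.integral_smul_const, integral_pow]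
    simp
  have hext : ∀ (r : J → ℝ), ∀ y ∈ s, ∀ v,
      extDeriv (fun y => ∑ j, r j • c j y) y v = ∑ j, r j • extDeriv (c j) y v :=
    fun r y hy v => by
      rw [extDeriv_sum_smul fun j =>
        ((hc j).contDiffAt (hs.mem_nhds hy)).differentiableAt (by simp : (∞ : WithTop ℕ∞) ≠ 0)]
      simp only [ContinuousAlternatingMap.sum_apply, ContinuousAlternatingMap.smul_apply]
  have hφ : ∀ t, ∀ y ∈ s, ∀ v, extDeriv (φ t) y v = ∑ j, t ^ d j • extDeriv (c j) y v :=
    fun t y hy v => by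
      rw [← hext _ y hy, Filter.EventuallyEq.extDeriv_eq]
      filter_upwards [hs.mem_nhds hy] with z hz using h t z hz
  refine ⟨fun y => ∑ j, ((d j : ℝ) + 1)⁻¹ • c j y,
    ContDiffOn.sum fun j _ => (hc j).const_smul _, fun y hy v => ?_, fun y hy v => ⟨?_, ?_⟩⟩
  · simp only [h _ y hy, ContinuousAlternatingMap.sum_apply, ContinuousAlternatingMap.smul_apply]
    exact key _
  · simp only [hφ _ y hy]
    fun_prop
  · simp only [hφ _ y hy, hext _ y hy]
    exact key _

end IsPolyFamily

/-! ### The Lie bracket and infinitesimal invariance -/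

section LieAlgebra

open scoped Matrix.Norms.Operator

variable {n : ℕ} {𝕜 : Type*} [RCLike 𝕜] {G : Subgroup (GL (Fin n) 𝕜)}

/-- The Lie bracket of `𝔤` as a continuous bilinear map. -/
noncomputable def bracketL (G : Subgroup (GL (Fin n) 𝕜)) :
    LieAlg G →L[ℝ] LieAlg G →L[ℝ] LieAlg G :=
  LinearMap.toContinuousBilinearMap <| LinearMap.mk₂ ℝ (fun X Y => lieBracket G ![X, Y])
    (fun X X' Y => LieAlg.val_injective (by simp [val_lieBracket]; noncomm_ring))
    (fun c X Y => LieAlg.val_injective (by simp [val_lieBracket, smul_sub]))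
    (fun X Y Y' => LieAlg.val_injective (by simp [val_lieBracket]; noncomm_ring))
    (fun c X Y => LieAlg.val_injective (by simp [val_lieBracket, smul_sub]))

lemma lieBracket_apply (X : Fin 2 → LieAlg G) : lieBracket G X = bracketL G (X 0) (X 1) :=
  LieAlg.val_injective rfl

lemma val_bracketL (X Y : LieAlg G) : (bracketL G X Y).val = X.val * Y.val - Y.val * X.val := rfl

lemma bracketL_swap (X Y : LieAlg G) : bracketL G X Y = -bracketL G Y X :=
  LieAlg.val_injective (by simp [val_bracketL])

lemma bracketL_jacobi (X Y Z : LieAlg G) : bracketL G X (bracketL G Y Z) +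
    bracketL G Y (bracketL G Z X) + bracketL G Z (bracketL G X Y) = 0 :=
  LieAlg.val_injective (by simp [val_bracketL]; noncomm_ring)

lemma val_Ad (g : G) (X : LieAlg G) : (Ad g X).val = toMat g * X.val * toMat g⁻¹ := rfl

/-- The inclusion of the Lie algebra as a continuous linear map. -/
noncomputable def valL (G : Subgroup (GL (Fin n) 𝕜)) : LieAlg G →L[ℝ] Matrix (Fin n) (Fin n) 𝕜 :=
  LieAlg.val.toContinuousLinearMap

/-- A matrix given by its entries, as a continuous linear map. -/
noncomputable def ofEntriesL (n : ℕ) (𝕜 : Type*) [RCLike 𝕜] :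
    (Fin n → Fin n → 𝕜) →L[ℝ] Matrix (Fin n) (Fin n) 𝕜 :=
  (Matrix.ofLinearEquiv ℝ).toLinearMap.toContinuousLinearMap

lemma hasDerivAt_of_val {f : ℝ → LieAlg G} {X : LieAlg G} {t : ℝ}
    (h : HasDerivAt (fun t => (f t).val) X.val t) : HasDerivAt f X t := by
  obtain ⟨r, hr⟩ := LinearMap.exists_leftInverse_of_injective (LieAlg.val (G := G))
    (LinearMap.ker_eq_bot.2 LieAlg.val_injective)
  have hr' : ∀ Y : LieAlg G, r Y.val = Y := fun Y => LinearMap.congr_fun hr Y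
  have := r.toContinuousLinearMap.hasFDerivAt.comp_hasDerivAt t h
  have hX : r.toContinuousLinearMap X.val = X := hr' X
  exact (this.congr_deriv hX).congr_of_eventuallyEq (.of_forall fun t => (hr' (f t)).symm)

lemma ringInverse_toMat (g : G) : Ring.inverse (toMat g) = toMat g⁻¹ := by
  rw [toMat, Ring.inverse_unit]
  rfl

/-- The derivative of the adjoint action along a curve through the identity is the bracket. -/
lemma hasDerivAt_Ad {γ : ℝ → G} (h0 : γ 0 = 1) {Z : LieAlg G}
    (hγ : ∀ i j, HasDerivAt (fun t => toMat (γ t) i j) (Z.val i j) 0) (X : LieAlg G) :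
    HasDerivAt (fun t => Ad (γ t) X) (bracketL G Z X) 0 := by
  apply hasDerivAt_of_val
  have h1 : HasDerivAt (fun t => toMat (γ t)) Z.val 0 :=
    (ofEntriesL n 𝕜).hasFDerivAt.comp_hasDerivAt (0 : ℝ)
      (hasDerivAt_pi.2 fun i => hasDerivAt_pi.2 fun j => hγ i j)
  have h2 : HasDerivAt (fun t => toMat (γ t)⁻¹) (-Z.val) 0 := by
    have h := hasFDerivAt_ringInverse (𝕜 := ℝ) (γ 0 : GL (Fin n) 𝕜)
    have := HasFDerivAt.comp_hasDerivAt (x := (0 : ℝ)) h h1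
    have hZ : (-((ContinuousLinearMap.mulLeftRight ℝ (Matrix (Fin n) (Fin n) 𝕜))
        ((γ 0 : GL (Fin n) 𝕜)⁻¹ : GL (Fin n) 𝕜).1) ((γ 0 : GL (Fin n) 𝕜)⁻¹ : GL (Fin n) 𝕜).1) Z.val =
        -Z.val := by
      simp [h0]
    rw [hZ] at this
    exact this.congr_of_eventuallyEq (.of_forall fun t => (ringInverse_toMat (γ t)).symm)
  have := (h1.mul_const X.val).mul h2
  have hZ : Z.val * X.val * toMat (γ 0)⁻¹ + toMat (γ 0) * X.val * -Z.val =
      (bracketL G Z X).val := by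
    simp [h0, val_bracketL, sub_eq_add_neg]
  rw [hZ] at this
  exact this

/-- Infinitesimal invariance: an `Ad`-invariant polynomial is annihilated by the derivation `[Z, ·]`. -/
lemma AdInvariantPolynomial.sum_update_bracketL {l : ℕ} (P : AdInvariantPolynomial G l)
    (Z : LieAlg G) (X : Fin l → LieAlg G) :
    ∑ i, P.toMultilinearMap (Function.update X i (bracketL G Z (X i))) = 0 := by
  obtain ⟨γ, h0, -, hγ⟩ := Z.val_mem
  let μ : ContinuousMultilinearMap ℝ (fun _ : Fin l => LieAlg G) ℂ :=
    ⟨P.toMultilinearMap, continuous_multilinearMap _⟩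
  have h1 : HasDerivAt (fun t i => Ad (γ t) (X i)) (fun i => bracketL G Z (X i)) 0 :=
    hasDerivAt_pi.2 fun i => hasDerivAt_Ad h0 hγ (X i)
  have h2 := HasFDerivAt.comp_hasDerivAt (x := (0 : ℝ)) (μ.hasFDerivAt _) h1
  have hX : (fun i => Ad (γ 0) (X i)) = X := funext fun i =>
    LieAlg.val_injective (by simp [val_Ad, h0])
  have h3 : (μ ∘ fun t i => Ad (γ t) (X i)) = fun _ => P.toMultilinearMap X :=
    funext fun t => P.map_ad (γ t) X
  rw [h3, ContinuousMultilinearMap.linearDeriv_apply, hX] at h2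
  exact h2.unique (hasDerivAt_const _ _)

end LieAlgebra

/-! ### Curvature in a vector space -/

section altSum

variable {T W : Type*} [AddCommGroup W]

lemma altSum_one (H : (Fin 1 → T) → W) (v : Fin 1 → T) : altSum H v = H v := by
  simp [altSum]

lemma altSum_two (f : T → T → W) (v : Fin 2 → T) :
    altSum (fun w => f (w 0) (w 1)) v = f (v 0) (v 1) - f (v 1) (v 0) := by
  have := altSum_succ (K := 1) (fun u w => f u (w 0)) v
  rw [show (fun w : Fin 2 → T => f (w 0) (w 1)) = fun w => f (w 0) (w (Fin.succ 0)) from rfl, this]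
  simp [Fin.sum_univ_two, altSum_one, Fin.removeNth, sub_eq_add_neg]

end altSum

lemma val_slot {l : ℕ} {k : Fin l → ℕ} {N : ℕ} (hN : ∑ i, k i = N) (i : Fin l) (j : Fin (k i)) :
    (slot hN i j : ℕ) = ∑ m : Fin (i : ℕ), k (Fin.castLE i.2.le m) + j :=
  finSigmaFinEquiv_apply _

section curvature

variable {n : ℕ} {𝕜 : Type*} [RCLike 𝕜] {G : Subgroup (GL (Fin n) 𝕜)}

lemma multiWedge_lieBracket_apply {T : Type*} [AddCommGroup T] [Module ℝ T] [TopologicalSpace T]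
    (h : ∑ _i : Fin 2, 1 = 2) (a b : T [⋀^Fin 1]→L[ℝ] LieAlg G) (v : Fin 2 → T) :
    multiWedge (lieBracket G) (k := fun _ => 1) h ![a, b] v =
      bracketL G (a ![v 0]) (b ![v 1]) - bracketL G (a ![v 1]) (b ![v 0]) := by
  rw [multiWedge_eq_altSum, ← altSum_two fun u u' => bracketL G (a ![u]) (b ![u'])]
  simp only [Nat.factorial_one, Finset.prod_const_one, Nat.cast_one, inv_one, one_smul]
  congr 1
  funext w
  have h0 : slot (k := fun _ => 1) h 0 0 = 0 := Fin.ext (by simp [val_slot])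
  have h1 : slot (k := fun _ => 1) h 1 0 = 1 := Fin.ext (by simp [val_slot])
  rw [lieBracket_apply]
  congr 2
  · rw [Matrix.cons_val_zero]
    congr 1
    exact funext fun j => by rw [Subsingleton.elim j 0, h0]; rfl
  · exact funext fun j => by rw [Subsingleton.elim j 0, h1]; rfl

variable {E : Type*} [NormedAddCommGroup E] [NormedSpace ℝ E]

/-- The curvature `da + ½ [a, a]` of a `𝔤`-valued `1`-form on a normed space. -/
noncomputable def localCurv (a : E → E [⋀^Fin 1]→L[ℝ] LieAlg G) (y : E) :
    E [⋀^Fin 2]→L[ℝ] LieAlg G :=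
  extDeriv a y + (1 / 2 : ℝ) • multiWedge (lieBracket G) (k := fun _ => 1) (by simp) ![a y, a y]

/-- The covariant derivative `∇_u b = D_u b + [a u, b]` of the `𝔤`-valued form `b`. -/
noncomputable def covDeriv {k : ℕ} (a : E → E [⋀^Fin 1]→L[ℝ] LieAlg G)
    (b : E → E [⋀^Fin k]→L[ℝ] LieAlg G) (y u : E) (w : Fin k → E) : LieAlg G :=
  fderiv ℝ b y u w + bracketL G (a y ![u]) (b y w)

lemma extDeriv_one_apply {V : Type*} [NormedAddCommGroup V] [NormedSpace ℝ V]
    (a : E → E [⋀^Fin 1]→L[ℝ] V) (y u v : E) :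
    extDeriv a y ![u, v] = fderiv ℝ a y u ![v] - fderiv ℝ a y v ![u] := by
  rw [extDeriv, ContinuousAlternatingMap.alternatizeUncurryFin_apply, Fin.sum_univ_two]
  have h0 : Fin.removeNth 0 ![u, v] = ![v] := by ext j; fin_cases j; rfl
  have h1 : Fin.removeNth 1 ![u, v] = ![u] := by ext j; fin_cases j; rfl
  simp [h0, h1, sub_eq_add_neg]

lemma localCurv_apply (a : E → E [⋀^Fin 1]→L[ℝ] LieAlg G) (y u v : E) :
    localCurv a y ![u, v] = fderiv ℝ a y u ![v] - fderiv ℝ a y v ![u]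
      + bracketL G (a y ![u]) (a y ![v]) := by
  rw [localCurv, ContinuousAlternatingMap.add_apply, ContinuousAlternatingMap.smul_apply,
    multiWedge_lieBracket_apply, extDeriv_one_apply]
  simp only [Matrix.cons_val_zero, Matrix.cons_val_one]
  rw [bracketL_swap (a y ![v]), sub_neg_eq_add, ← two_smul ℝ, smul_smul]
  norm_num

end curvature

section local_forms

variable {n : ℕ} {𝕜 : Type*} [RCLike 𝕜] {G : Subgroup (GL (Fin n) 𝕜)}
  {E : Type*} [NormedAddCommGroup E] [NormedSpace ℝ E]

lemma contDiffOn_localCurv {a : E → E [⋀^Fin 1]→L[ℝ] LieAlg G} {s : Set E} (hs : IsOpen s)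
    (ha : ContDiffOn ℝ ∞ a s) : ContDiffOn ℝ ∞ (localCurv a) s := by
  refine ContDiffOn.add ?_ (ContDiffOn.const_smul _ (.multiWedge _ _ ?_))
  · have h1 : ContDiffOn ℝ ∞ (fderiv ℝ a) s := ha.fderiv_of_isOpen hs (by simp)
    exact (ContinuousAlternatingMap.alternatizeUncurryFinCLM ℝ E (LieAlg G)).contDiff.comp_contDiffOn h1
  · intro i
    fin_cases i <;> exact ha

lemma hasFDerivAt_apply_tuple {V : Type*} [NormedAddCommGroup V] [NormedSpace ℝ V] {k : ℕ}
    {b : E → E [⋀^Fin k]→L[ℝ] V} {b' : E →L[ℝ] E [⋀^Fin k]→L[ℝ] V} {y : E}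
    (hb : HasFDerivAt b b' y) (w : Fin k → E) :
    HasFDerivAt (fun z => b z w) ((ContinuousAlternatingMap.apply ℝ E V w).comp b') y :=
  (ContinuousAlternatingMap.apply ℝ E V w).hasFDerivAt.comp y hb

lemma hasFDerivAt_fderiv_apply {V : Type*} [NormedAddCommGroup V] [NormedSpace ℝ V] {b : E → V}
    {y : E} (hb : DifferentiableAt ℝ (fderiv ℝ b) y) (v : E) :
    HasFDerivAt (fun z => fderiv ℝ b z v) ((fderiv ℝ (fderiv ℝ b) y).flip v) y := by
  have h := hb.hasFDerivAt.clm_apply (hasFDerivAt_const v y)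
  rwa [ContinuousLinearMap.comp_zero, zero_add] at h

/-- The Bianchi identity. -/
lemma bianchi {a : E → E [⋀^Fin 1]→L[ℝ] LieAlg G} {s : Set E} (hs : IsOpen s)
    (ha : ContDiffOn ℝ ∞ a s) {y : E} (hy : y ∈ s) (u v w : E) :
    covDeriv a (localCurv a) y u ![v, w] + covDeriv a (localCurv a) y v ![w, u]
      + covDeriv a (localCurv a) y w ![u, v] = 0 := by
  have hay : ContDiffAt ℝ ∞ a y := ha.contDiffAt (hs.mem_nhds hy)
  have hda : DifferentiableAt ℝ a y := hay.differentiableAt (by simp)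
  have hdF : DifferentiableAt ℝ (localCurv a) y :=
    ((contDiffOn_localCurv hs ha).contDiffAt (hs.mem_nhds hy)).differentiableAt (by simp)
  have hdd : DifferentiableAt ℝ (fderiv ℝ a) y :=
    (hay.fderiv_right (m := 1) (by norm_cast)).differentiableAt (by simp)
  have hsymm : ∀ u v, fderiv ℝ (fderiv ℝ a) y u v = fderiv ℝ (fderiv ℝ a) y v u := fun u v =>
    (hay.isSymmSndFDerivAt (by simpa using ENat.LEInfty.out)).eq u v
  have hD : ∀ v w : E, HasFDerivAt (fun z => fderiv ℝ a z v ![w])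
      ((ContinuousAlternatingMap.apply ℝ E (LieAlg G) ![w]).comp
        ((fderiv ℝ (fderiv ℝ a) y).flip v)) y := fun v w => by
    exact hasFDerivAt_apply_tuple (hasFDerivAt_fderiv_apply hdd v) ![w]
  have hF : ∀ u v w : E, fderiv ℝ (localCurv a) y u ![v, w] =
      fderiv ℝ (fderiv ℝ a) y u v ![w] - fderiv ℝ (fderiv ℝ a) y u w ![v]
      + (bracketL G (a y ![v]) (fderiv ℝ a y u ![w])
        + bracketL G (fderiv ℝ a y u ![v]) (a y ![w])) := fun u v w => by
    have h1 := hasFDerivAt_apply_tuple hdF.hasFDerivAt ![v, w]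
    have h2 := ((hD v w).sub (hD w v)).add
      ((bracketL G).hasFDerivAt_of_bilinear (hasFDerivAt_apply_tuple hda.hasFDerivAt ![v])
        (hasFDerivAt_apply_tuple hda.hasFDerivAt ![w]))
    have h3 := h1.unique (h2.congr_of_eventuallyEq (.of_forall fun z => localCurv_apply a z v w))
    exact DFunLike.congr_fun h3 u
  simp only [covDeriv, hF, localCurv_apply, map_add, map_sub]
  rw [hsymm v u, hsymm w u, hsymm w v, ← bracketL_jacobi (a y ![u]) (a y ![v]) (a y ![w]),
    bracketL_swap (fderiv ℝ a y u ![v]), bracketL_swap (fderiv ℝ a y v ![w]),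
    bracketL_swap (fderiv ℝ a y w ![u])]
  abel

variable {l : ℕ}

/-- Since an invariant polynomial is annihilated by the bracket, the derivatives in the Leibniz rule
may be replaced by covariant ones. -/
lemma extDeriv_invariant_apply (P : AdInvariantPolynomial G l)
    (a : E → E [⋀^Fin 1]→L[ℝ] LieAlg G) {k : Fin l → ℕ} {N : ℕ} (hN : ∑ i, k i = N)
    {θ : (i : Fin l) → E → E [⋀^Fin (k i)]→L[ℝ] LieAlg G} {y : E}
    (hθ : ∀ i, DifferentiableAt ℝ (θ i) y) (v : Fin (N + 1) → E) :
    extDeriv (fun y => multiWedge P.toMultilinearMap hN fun i => θ i y) y v =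
      ((∏ i, (k i).factorial : ℕ) : ℝ)⁻¹ • ∑ i, altSum (fun w =>
        P.toMultilinearMap (Function.update (fun i' => θ i' y fun j => w (slot hN i' j).succ) i
          (covDeriv a (θ i) y (w 0) fun j => w (slot hN i j).succ))) v := by
  rw [extDeriv_multiWedge_apply _ _ hθ, ← altSum_sum]
  congr 2
  funext w
  simp only [covDeriv, MultilinearMap.map_update_add, Finset.sum_add_distrib]
  rw [P.sum_update_bracketL (a y ![w 0]) fun i' => θ i' y fun j => w (slot hN i' j).succ, add_zero]

/-- A term in which the covariant derivative falls on a curvature factor is killed by the Bianchi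
identity. -/
lemma altSum_covDeriv_curvature (μ : MultilinearMap ℝ (fun _ : Fin l => LieAlg G) ℂ)
    {a : E → E [⋀^Fin 1]→L[ℝ] LieAlg G} {s : Set E} (hs : IsOpen s)
    (ha : ContDiffOn ℝ ∞ a s) {y : E} (hy : y ∈ s) {k : Fin l → ℕ} {N : ℕ} (hN : ∑ i, k i = N)
    (θ : (i : Fin l) → E [⋀^Fin (k i)]→L[ℝ] LieAlg G) (i : Fin l) (hi : 2 = k i)
    (v : Fin (N + 1) → E) :
    altSum (fun w => μ (Function.update (fun i' => θ i' fun j => w (slot hN i' j).succ) i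
      (covDeriv a (localCurv a) y (w 0) fun j => w (slot hN i (finCongr hi j)).succ))) v = 0 := by
  have hinj : ∀ {i i' : Fin l} {j : Fin (k i)} {j' : Fin (k i')},
      (slot hN i j).succ = (slot hN i' j').succ →
        (⟨i, j⟩ : (i : Fin l) × Fin (k i)) = ⟨i', j'⟩ :=
    fun h => slot_injective hN (Fin.succ_injective _ h)
  have h01 : (slot hN i (finCongr hi 0)).succ ≠ (slot hN i (finCongr hi 1)).succ := fun h => by
    have := hinj h
    simp at this
  have h0 : ∀ i' j, (slot hN i' j).succ ≠ 0 := fun i' j => Fin.succ_ne_zero _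
  refine altSum_eq_zero_of_cyclic _ (h0 i _).symm h01 (h0 i _).symm (fun w => ?_) v
  set p := (slot hN i (finCongr hi 0)).succ with hp
  set q := (slot hN i (finCongr hi 1)).succ with hq
  have hp0 : p ≠ 0 := h0 _ _
  have hq0 : q ≠ 0 := h0 _ _
  -- The arguments of the other factors are fixed by the cyclic permutations of `0, p, q`.
  have hother : ∀ ρ : Equiv.Perm (Fin (N + 1)), (∀ m, m ≠ 0 → m ≠ p → m ≠ q → ρ m = m) →
      ∀ X, Function.update (fun i' => θ i' fun j => (w ∘ ρ) (slot hN i' j).succ) i X =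
        Function.update (fun i' => θ i' fun j => w (slot hN i' j).succ) i X := by
    intro ρ hρ X
    ext i' : 1
    rcases eq_or_ne i' i with rfl | hii
    · simp
    · rw [Function.update_of_ne hii, Function.update_of_ne hii]
      congr 1
      funext j
      rw [Function.comp_apply, hρ _ (h0 _ _)] <;>
        exact fun h => hii (congrArg Sigma.fst (hinj h))
  have htuple : ∀ w : Fin (N + 1) → E, (fun j : Fin 2 => w (slot hN i (finCongr hi j)).succ) =
      ![w p, w q] := fun w => by
    ext j
    fin_cases j <;> rfl
  simp only [htuple]
  rw [hother, hother, ← MultilinearMap.map_update_add, ← MultilinearMap.map_update_add]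
  · have e1 : (w ∘ (Equiv.swap 0 p * Equiv.swap p q : Equiv.Perm (Fin (N + 1)))) 0 = w p := by
      simp [Equiv.swap_apply_of_ne_of_ne hp0.symm hq0.symm]
    have e2 : (w ∘ (Equiv.swap 0 p * Equiv.swap p q : Equiv.Perm (Fin (N + 1)))) p = w q := by
      simp [Equiv.swap_apply_of_ne_of_ne hq0 h01.symm]
    have e3 : (w ∘ (Equiv.swap 0 p * Equiv.swap p q : Equiv.Perm (Fin (N + 1)))) q = w 0 := by
      simp
    have e4 : (w ∘ (Equiv.swap 0 q * Equiv.swap q p : Equiv.Perm (Fin (N + 1)))) 0 = w q := by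
      simp [Equiv.swap_apply_of_ne_of_ne hq0.symm hp0.symm]
    have e5 : (w ∘ (Equiv.swap 0 q * Equiv.swap q p : Equiv.Perm (Fin (N + 1)))) p = w 0 := by
      simp
    have e6 : (w ∘ (Equiv.swap 0 q * Equiv.swap q p : Equiv.Perm (Fin (N + 1)))) q = w p := by
      simp [Equiv.swap_apply_of_ne_of_ne hp0 h01]
    rw [e1, e2, e3, e4, e5, e6, bianchi hs ha hy]
    exact MultilinearMap.map_coord_zero _ i (by simp)
  · intro m h1 h2 h3
    simp [Equiv.swap_apply_of_ne_of_ne, h1, h2, h3]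
  · intro m h1 h2 h3
    simp [Equiv.swap_apply_of_ne_of_ne, h1, h2, h3]

/-- The alternating form `P(F, …, F)` of a `𝔤`-valued alternating `2`-form on a vector space. -/
noncomputable def evalPow {T : Type*} [AddCommGroup T] [Module ℝ T] [TopologicalSpace T]
    (P : AdInvariantPolynomial G l) (F : T [⋀^Fin 2]→L[ℝ] LieAlg G) : T [⋀^Fin (2 * l)]→L[ℝ] ℂ :=
  multiWedge P.toMultilinearMap (k := fun _ => 2) (by simp [mul_comm]) fun _ => F

/-- The alternating form `P(F, …, F, B)` of a `𝔤`-valued alternating `2`-form `F`, in the first `l - 1`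
slots, and a `𝔤`-valued `1`-form `B`, in the last slot. -/
noncomputable def evalPowLast {T : Type*} [AddCommGroup T] [Module ℝ T] [TopologicalSpace T]
    (P : AdInvariantPolynomial G l) (F : T [⋀^Fin 2]→L[ℝ] LieAlg G)
    (B : T [⋀^Fin 1]→L[ℝ] LieAlg G) : T [⋀^Fin (2 * l - 1)]→L[ℝ] ℂ :=
  multiWedge P.toMultilinearMap (sum_degrees l) fun i =>
    if h : (i : ℕ) + 1 = l then castAlternating (if_pos h).symm B
    else castAlternating (if_neg h).symm F

lemma extDeriv_evalPow (P : AdInvariantPolynomial G l)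
    {a : E → E [⋀^Fin 1]→L[ℝ] LieAlg G} {s : Set E} (hs : IsOpen s)
    (ha : ContDiffOn ℝ ∞ a s) {y : E} (hy : y ∈ s) :
    extDeriv (fun y => evalPow P (localCurv a y)) y = 0 := by
  ext v
  have hdF : DifferentiableAt ℝ (localCurv a) y :=
    ((contDiffOn_localCurv hs ha).contDiffAt (hs.mem_nhds hy)).differentiableAt (by simp)
  unfold evalPow
  rw [extDeriv_invariant_apply P a _ fun _ => hdF, Finset.sum_eq_zero, smul_zero]
  · rfl
  · intro i _
    exact altSum_covDeriv_curvature _ hs ha hy _ (fun _ => localCurv a y) i rfl v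

end local_forms

/-! ### The transgression formula in a vector space -/

lemma castAlternating_apply {T V : Type*} [AddCommGroup T] [Module ℝ T] [TopologicalSpace T]
    [NormedAddCommGroup V] [NormedSpace ℝ V] {k k' : ℕ} (h : k = k') (a : T [⋀^Fin k]→L[ℝ] V)
    (v : Fin k' → T) : castAlternating h a v = a fun m => v (finCongr h m) := rfl

lemma altSum_finCongr {T W : Type*} [AddCommGroup W] {K K' : ℕ} (h : K = K')
    (H : (Fin K → T) → W) (v : Fin K' → T) :
    altSum (fun w => H fun m => w (finCongr h m)) v = altSum H fun m => v (finCongr h m) := by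
  subst h
  rfl

lemma IsPolyFamily.castAlternating {X T V : Type*} [NormedAddCommGroup X] [NormedSpace ℝ X]
    [NormedAddCommGroup T] [NormedSpace ℝ T] [NormedAddCommGroup V] [NormedSpace ℝ V] {k k' : ℕ}
    (h : k = k') {s : Set X} {φ : ℝ → X → T [⋀^Fin k]→L[ℝ] V} (hφ : IsPolyFamily s φ) :
    IsPolyFamily s fun t y => ChernWeil.castAlternating h (φ t y) := by
  subst h
  exact hφ

section curvature

variable {n : ℕ} {𝕜 : Type*} [RCLike 𝕜] {G : Subgroup (GL (Fin n) 𝕜)}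
  {E : Type*} [NormedAddCommGroup E] [NormedSpace ℝ E] {l : ℕ}

lemma isPolyFamily_localCurv {a b : E → E [⋀^Fin 1]→L[ℝ] LieAlg G} {s : Set E} (hs : IsOpen s)
    (ha : ContDiffOn ℝ ∞ a s) (hb : ContDiffOn ℝ ∞ b s) :
    IsPolyFamily s fun t => localCurv (a + t • b) := by
  have h : IsPolyFamily s fun t => a + t • b :=
    (IsPolyFamily.const ha).add ((IsPolyFamily.const hb).smul_param)
  exact (h.exteriorDeriv hs).add (.const_smul _ (.multiWedge _ _ fun i => by fin_cases i <;> exact h))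

lemma isPolyFamily_evalPowLast (P : AdInvariantPolynomial G l)
    {a b : E → E [⋀^Fin 1]→L[ℝ] LieAlg G} {s : Set E} (hs : IsOpen s)
    (ha : ContDiffOn ℝ ∞ a s) (hb : ContDiffOn ℝ ∞ b s) :
    IsPolyFamily s fun t y => evalPowLast P (localCurv (a + t • b) y) (b y) := by
  refine .multiWedge _ _ fun i => ?_
  by_cases h : (i : ℕ) + 1 = l
  · simp only [dif_pos h]
    exact (IsPolyFamily.const hb).castAlternating _
  · simp only [dif_neg h]
    exact (isPolyFamily_localCurv hs ha hb).castAlternating _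

lemma hasDerivAt_localCurv {a b : E → E [⋀^Fin 1]→L[ℝ] LieAlg G} {y : E}
    (ha : DifferentiableAt ℝ a y) (hb : DifferentiableAt ℝ b y) (t : ℝ) (u v : E) :
    HasDerivAt (fun t : ℝ => localCurv (a + t • b) y ![u, v])
      (covDeriv (a + t • b) b y u ![v] - covDeriv (a + t • b) b y v ![u]) t := by
  have hlin : ∀ (x z : LieAlg G), HasDerivAt (fun t : ℝ => x + t • z) z t := fun x z => by
    simpa using ((hasDerivAt_id t).smul_const z).const_add x
  have hfd : ∀ (t : ℝ) (u v : E), fderiv ℝ (a + t • b) y u ![v] =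
      fderiv ℝ a y u ![v] + t • fderiv ℝ b y u ![v] := fun t u v => by
    rw [fderiv_add ha (hb.const_smul t), fderiv_const_smul hb]
    rfl
  have h := ((hlin (fderiv ℝ a y u ![v]) (fderiv ℝ b y u ![v])).sub
    (hlin (fderiv ℝ a y v ![u]) (fderiv ℝ b y v ![u]))).add
    ((bracketL G).hasFDerivAt_of_bilinear (hlin (a y ![u]) (b y ![u])).hasFDerivAt
      (hlin (a y ![v]) (b y ![v])).hasFDerivAt).hasDerivAt
  refine (h.congr_deriv ?_).congr_of_eventuallyEq (.of_forall fun t => ?_)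
  · simp only [covDeriv, Pi.add_apply, Pi.smul_apply, ContinuousAlternatingMap.add_apply,
      ContinuousAlternatingMap.smul_apply]
    simp
    rw [bracketL_swap (b y ![u]) (a y ![v]), bracketL_swap (b y ![v]) (b y ![u])]
    module
  · simp only [localCurv_apply, hfd]
    rfl

/-- The derivative of `P(F, …, F)` is a sum over the factors. -/
lemma hasDerivAt_evalPow (P : AdInvariantPolynomial G l) {T : Type*} [AddCommGroup T] [Module ℝ T]
    [TopologicalSpace T] {F : ℝ → T [⋀^Fin 2]→L[ℝ] LieAlg G} {D : T → T → LieAlg G} {t : ℝ}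
    (hF : ∀ u v, HasDerivAt (fun t => F t ![u, v]) (D u v) t) (hN : ∑ _i : Fin l, 2 = 2 * l)
    (v : Fin (2 * l) → T) :
    HasDerivAt (fun t => evalPow P (F t) v) (((2 ^ l : ℕ) : ℝ)⁻¹ • ∑ i, altSum (fun w =>
      P.toMultilinearMap (Function.update
        (fun i' => F t ![w (slot (k := fun _ => 2) hN i' 0), w (slot (k := fun _ => 2) hN i' 1)]) i
        (D (w (slot (k := fun _ => 2) hN i 0)) (w (slot (k := fun _ => 2) hN i 1))))) v) t := by
  let μ : ContinuousMultilinearMap ℝ (fun _ : Fin l => LieAlg G) ℂ :=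
    ⟨P.toMultilinearMap, continuous_multilinearMap _⟩
  have hμ : ∀ w : Fin (2 * l) → T, HasDerivAt (fun t => μ fun i' =>
      F t ![w (slot (k := fun _ => 2) hN i' 0), w (slot (k := fun _ => 2) hN i' 1)])
      (∑ i, P.toMultilinearMap (Function.update
        (fun i' => F t ![w (slot (k := fun _ => 2) hN i' 0), w (slot (k := fun _ => 2) hN i' 1)]) i
        (D (w (slot (k := fun _ => 2) hN i 0)) (w (slot (k := fun _ => 2) hN i 1))))) t := fun w => by
    have h := HasFDerivAt.comp_hasDerivAt t (μ.hasFDerivAt _)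
      (hasDerivAt_pi.2 fun i => hF (w (slot (k := fun _ => 2) hN i 0))
        (w (slot (k := fun _ => 2) hN i 1)))
    rw [ContinuousMultilinearMap.linearDeriv_apply] at h
    exact h
  have h : HasDerivAt (fun t => altSum (fun w => μ fun i' =>
      F t ![w (slot (k := fun _ => 2) hN i' 0), w (slot (k := fun _ => 2) hN i' 1)]) v) (altSum (fun w => ∑ i,
      P.toMultilinearMap (Function.update
        (fun i' => F t ![w (slot (k := fun _ => 2) hN i' 0), w (slot (k := fun _ => 2) hN i' 1)]) i
        (D (w (slot (k := fun _ => 2) hN i 0)) (w (slot (k := fun _ => 2) hN i 1))))) v) t := by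
    unfold altSum
    refine HasDerivAt.fun_sum fun σ _ => ?_
    have := hμ (v ∘ σ)
    rcases Int.units_eq_one_or (Equiv.Perm.sign σ) with h | h
    · simpa only [h, one_smul] using this
    · simpa only [h, Units.neg_smul, one_smul] using this.fun_neg
  rw [← altSum_sum]
  refine (h.const_smul ((2 ^ l : ℕ) : ℝ)⁻¹).congr_of_eventuallyEq (.of_forall fun t => ?_)
  simp only [evalPow, multiWedge_eq_altSum, Finset.prod_const, Nat.factorial_two, Finset.card_univ,
    Fintype.card_fin]
  congr 2
  funext w
  refine congrArg P.toMultilinearMap (funext fun i => congrArg (F t) (funext fun j => ?_))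
  fin_cases j <;> rfl

/-- By the symmetry of `P`, and since `2`-forms commute, it does not matter which factor carries the
distinguished entry. -/
lemma altSum_update_perm (P : AdInvariantPolynomial G l) {T : Type*}
    (F D : T → T → LieAlg G) (hN : ∑ _i : Fin l, 2 = 2 * l) (σ : Equiv.Perm (Fin l)) (i : Fin l)
    (v : Fin (2 * l) → T) :
    altSum (fun w => P.toMultilinearMap (Function.update
        (fun i' => F (w (slot (k := fun _ => 2) hN i' 0)) (w (slot (k := fun _ => 2) hN i' 1))) (σ i)
        (D (w (slot (k := fun _ => 2) hN (σ i) 0)) (w (slot (k := fun _ => 2) hN (σ i) 1))))) v =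
    altSum (fun w => P.toMultilinearMap (Function.update
        (fun i' => F (w (slot (k := fun _ => 2) hN i' 0)) (w (slot (k := fun _ => 2) hN i' 1))) i
        (D (w (slot (k := fun _ => 2) hN i 0)) (w (slot (k := fun _ => 2) hN i 1))))) v := by
  let f : Fin l × Fin 2 ≃ Fin (2 * l) :=
    (Equiv.sigmaEquivProd (Fin l) (Fin 2)).symm.trans (finSigmaFinEquiv.trans (finCongr hN))
  have hf : ∀ i j, f (i, j) = slot (k := fun _ => 2) hN i j := fun i j => rfl
  let ρ : Equiv.Perm (Fin (2 * l)) := f.permCongr (Equiv.prodCongrLeft fun _ : Fin 2 => σ)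
  have hρ : ∀ i j, ρ (slot (k := fun _ => 2) hN i j) = slot (k := fun _ => 2) hN (σ i) j := by
    intro i j
    rw [← hf, ← hf]
    simp [ρ, Equiv.permCongr_apply]
  have hsign : Equiv.Perm.sign ρ = 1 := by
    simp [ρ, Equiv.Perm.sign_permCongr, Equiv.Perm.sign_prodCongrLeft, Int.units_sq]
  have h := altSum_comp_perm (fun w => P.toMultilinearMap (Function.update
    (fun i' => F (w (slot (k := fun _ => 2) hN i' 0)) (w (slot (k := fun _ => 2) hN i' 1))) i
    (D (w (slot (k := fun _ => 2) hN i 0)) (w (slot (k := fun _ => 2) hN i 1))))) ρ v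
  rw [hsign, one_smul] at h
  rw [← h]
  simp only [Function.comp_apply, hρ]
  congr 1
  funext w
  rw [← P.map_perm σ]
  congr 1
  funext i'
  rcases eq_or_ne i' i with rfl | h
  · simp
  · rw [Function.update_of_ne (σ.injective.ne h), Function.update_of_ne h]

end curvature

section transgression

lemma prod_factorial_degrees (l : ℕ) :
    ∏ i : Fin l, (if (i : ℕ) + 1 = l then 1 else 2).factorial = 2 ^ (l - 1) := by
  cases l with
  | zero => rfl
  | succ m =>
    rw [Fin.prod_univ_castSucc, Finset.prod_congr rfl fun i _ => by
      rw [if_neg (show ¬ ((Fin.castSucc i : Fin (m + 1)) : ℕ) + 1 = m + 1 by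
        have := i.2; simp; omega)]]
    simp

lemma val_slot_two {l : ℕ} (hN : ∑ _i : Fin l, 2 = 2 * l) (i : Fin l) (j : Fin 2) :
    (slot (k := fun _ => 2) hN i j : ℕ) = 2 * i + j := by
  rw [val_slot]
  simp [mul_comm]

lemma val_slot_degrees {l : ℕ} (i : Fin l) (j : Fin (if (i : ℕ) + 1 = l then 1 else 2)) :
    (slot (k := fun i : Fin l => if (i : ℕ) + 1 = l then 1 else 2) (sum_degrees l) i j : ℕ) =
      2 * i + j := by
  rw [val_slot, Finset.sum_congr rfl fun m _ => if_neg
    (show ¬ ((Fin.castLE i.2.le m : Fin l) : ℕ) + 1 = l by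
      have := i.2; have := m.2; simp; omega)]
  simp [mul_comm]

variable {n : ℕ} {𝕜 : Type*} [RCLike 𝕜] {G : Subgroup (GL (Fin n) 𝕜)}
  {E : Type*} [NormedAddCommGroup E] [NormedSpace ℝ E] {l : ℕ}

lemma covDeriv_castAlternating {k k' : ℕ} (h : k = k') (a : E → E [⋀^Fin 1]→L[ℝ] LieAlg G)
    (b : E → E [⋀^Fin k]→L[ℝ] LieAlg G) (y u : E) (w : Fin k' → E) :
    covDeriv a (fun y => castAlternating h (b y)) y u w =
      covDeriv a b y u fun m => w (finCongr h m) := by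
  subst h
  rfl

lemma differentiableAt_castAlternating {V : Type*} [NormedAddCommGroup V] [NormedSpace ℝ V]
    {k k' : ℕ} (h : k = k') {b : E → E [⋀^Fin k]→L[ℝ] V} {y : E} (hb : DifferentiableAt ℝ b y) :
    DifferentiableAt ℝ (fun y => castAlternating h (b y)) y := by
  subst h
  exact hb

/-- The exterior derivative of `P(F, …, F, B)`, where the derivative has to fall on `B`. -/
lemma extDeriv_evalPowLast (P : AdInvariantPolynomial G l) (last : Fin l)
    (hlast : (last : ℕ) + 1 = l) {a b : E → E [⋀^Fin 1]→L[ℝ] LieAlg G} {s : Set E}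
    (hs : IsOpen s) (ha : ContDiffOn ℝ ∞ a s) (hb : ContDiffOn ℝ ∞ b s) {y : E} (hy : y ∈ s)
    (hN : ∑ _i : Fin l, 2 = 2 * l) (hl : 2 * l - 1 + 1 = 2 * l) (v : Fin (2 * l) → E) :
    extDeriv (fun y => evalPowLast P (localCurv a y) (b y)) y (fun m => v (finCongr hl m)) =
      ((2 ^ (l - 1) : ℕ) : ℝ)⁻¹ • altSum (fun w => P.toMultilinearMap (Function.update
        (fun i' => localCurv a y
          ![w (slot (k := fun _ => 2) hN i' 0), w (slot (k := fun _ => 2) hN i' 1)]) last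
        (covDeriv a b y (w (slot (k := fun _ => 2) hN last 0))
          ![w (slot (k := fun _ => 2) hN last 1)]))) v := by
  have hdF : DifferentiableAt ℝ (localCurv a) y :=
    ((contDiffOn_localCurv hs ha).contDiffAt (hs.mem_nhds hy)).differentiableAt (by simp)
  have hdb : DifferentiableAt ℝ b y := (hb.contDiffAt (hs.mem_nhds hy)).differentiableAt (by simp)
  unfold evalPowLast
  rw [extDeriv_invariant_apply P a (sum_degrees l) fun i => ?_, prod_factorial_degrees,
    Finset.sum_eq_single last]
  rotate_left
  · intro i _ hi
    have hi' : ¬ (i : ℕ) + 1 = l := fun h => hi (Fin.ext (by omega))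
    simp only [dif_neg hi', covDeriv_castAlternating]
    exact altSum_covDeriv_curvature _ hs ha hy _ _ i (if_neg hi').symm _
  · simp
  · by_cases h : (i : ℕ) + 1 = l
    · simp only [dif_pos h]
      exact differentiableAt_castAlternating _ hdb
    · simp only [dif_neg h]
      exact differentiableAt_castAlternating _ hdF
  congr 1
  have hpos : 0 < 2 * l := by omega
  have : NeZero (2 * l) := ⟨hpos.ne'⟩
  -- The cycle of odd length `2l - 1` that moves the direction of differentiation next to the
  -- argument of `B`.
  let c : Fin (2 * l) := slot (k := fun _ => 2) hN last 0
  have hc : (c : ℕ) = 2 * l - 2 := by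
    have := val_slot_two hN last 0
    simp only [c, this]
    simp
    omega
  have hsign : Equiv.Perm.sign c.cycleRange = 1 := by
    rw [Fin.sign_cycleRange, hc]
    exact Even.neg_one_pow ⟨l - 1, by omega⟩
  rw [← altSum_finCongr]
  have h := altSum_comp_perm (fun w => P.toMultilinearMap (Function.update
        (fun i' => localCurv a y
          ![w (slot (k := fun _ => 2) hN i' 0), w (slot (k := fun _ => 2) hN i' 1)]) last
        (covDeriv a b y (w (slot (k := fun _ => 2) hN last 0))
          ![w (slot (k := fun _ => 2) hN last 1)]))) c.cycleRange v
  rw [hsign, one_smul] at h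
  rw [← h]
  congr 1
  funext w
  have hlast1 : c.cycleRange (slot (k := fun _ => 2) hN last 1) =
      slot (k := fun _ => 2) hN last 1 := by
    refine Fin.cycleRange_of_gt ?_
    rw [Fin.lt_def, val_slot_two, val_slot_two]
    simp
  have hlt : ∀ i', i' ≠ last → ∀ j, (c.cycleRange (slot (k := fun _ => 2) hN i' j) : ℕ) =
      2 * i' + j + 1 := fun i' hi j => by
    have hi' : ¬ (i' : ℕ) + 1 = l := fun h => hi (Fin.ext (by omega))
    rw [Fin.coe_cycleRange_of_lt, val_slot_two]
    rw [Fin.lt_def, val_slot_two, hc]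
    omega
  have hlast0 : c.cycleRange (slot (k := fun _ => 2) hN last 0) = 0 := Fin.cycleRange_self _
  simp only [Function.comp_apply, hlast0, hlast1]
  congr 1
  ext i' : 1
  rcases eq_or_ne i' last with rfl | hi
  · simp only [Function.update_self, dif_pos hlast, covDeriv_castAlternating]
    congr 1
    funext j
    rw [Matrix.cons_val_fin_one]
    congr 1
    refine Fin.ext ?_
    rw [finCongr_apply, Fin.val_cast, Fin.val_succ, val_slot_degrees, val_slot_two]
    simp
  · have hi' : ¬ (i' : ℕ) + 1 = l := fun h => hi (Fin.ext (by omega))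
    simp only [Function.update_of_ne hi, dif_neg hi', castAlternating_apply]
    congr 1
    funext j
    have : ∀ j : Fin 2, finCongr hl (slot (k := fun i : Fin l => if (i : ℕ) + 1 = l then 1 else 2)
        (sum_degrees l) i' (finCongr (if_neg hi').symm j)).succ =
        c.cycleRange (slot (k := fun _ => 2) hN i' j) := fun j => by
      refine Fin.ext ?_
      rw [hlt i' hi, finCongr_apply, Fin.val_cast, Fin.val_succ, val_slot_degrees]
      simp
    rw [this]
    fin_cases j <;> rfl

/-- The variation of `P(F, …, F)` along a segment of connections is exact. -/
lemma hasDerivAt_evalPow_localCurv (P : AdInvariantPolynomial G l) (hl : 2 * l - 1 + 1 = 2 * l)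
    {a b : E → E [⋀^Fin 1]→L[ℝ] LieAlg G} {s : Set E}
    (hs : IsOpen s) (ha : ContDiffOn ℝ ∞ a s) (hb : ContDiffOn ℝ ∞ b s) {y : E} (hy : y ∈ s)
    (v : Fin (2 * l) → E) (t : ℝ) :
    HasDerivAt (fun t : ℝ => evalPow P (localCurv (a + t • b) y) v)
      ((l : ℝ) • extDeriv (fun y => evalPowLast P (localCurv (a + t • b) y) (b y)) y
        fun m => v (finCongr hl m)) t := by
  have hN : ∑ _i : Fin l, 2 = 2 * l := by simp [mul_comm]
  have hda : DifferentiableAt ℝ a y := (ha.contDiffAt (hs.mem_nhds hy)).differentiableAt (by simp)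
  have hdb : DifferentiableAt ℝ b y := (hb.contDiffAt (hs.mem_nhds hy)).differentiableAt (by simp)
  let last : Fin l := ⟨l - 1, by omega⟩
  have hlast : (last : ℕ) + 1 = l := by simp only [last]; omega
  refine (hasDerivAt_evalPow P (hasDerivAt_localCurv hda hdb t) hN v).congr_deriv ?_
  set A := a + t • b
  have hA : ContDiffOn ℝ ∞ A s := ha.add (hb.const_smul t)
  rw [extDeriv_evalPowLast P last hlast hs hA hb hy hN hl v]
  set S := altSum (fun w => P.toMultilinearMap (Function.update
        (fun i' => localCurv A y
          ![w (slot (k := fun _ => 2) hN i' 0), w (slot (k := fun _ => 2) hN i' 1)]) last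
        (covDeriv A b y (w (slot (k := fun _ => 2) hN last 0))
          ![w (slot (k := fun _ => 2) hN last 1)]))) v with hS
  have hswap : altSum (fun w => P.toMultilinearMap (Function.update
        (fun i' => localCurv A y
          ![w (slot (k := fun _ => 2) hN i' 0), w (slot (k := fun _ => 2) hN i' 1)]) last
        (covDeriv A b y (w (slot (k := fun _ => 2) hN last 1))
          ![w (slot (k := fun _ => 2) hN last 0)]))) v = -S := by
    have hne : slot (k := fun _ => 2) hN last 0 ≠ slot (k := fun _ => 2) hN last 1 := fun h => by
      have := slot_injective hN h
      simp at this
    have h := altSum_comp_perm (fun w => P.toMultilinearMap (Function.update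
        (fun i' => localCurv A y
          ![w (slot (k := fun _ => 2) hN i' 0), w (slot (k := fun _ => 2) hN i' 1)]) last
        (covDeriv A b y (w (slot (k := fun _ => 2) hN last 0))
          ![w (slot (k := fun _ => 2) hN last 1)])))
        (Equiv.swap (slot (k := fun _ => 2) hN last 0) (slot (k := fun _ => 2) hN last 1)) v
    rw [Equiv.Perm.sign_swap hne, Units.neg_smul, one_smul, ← hS] at h
    rw [← h]
    congr 1
    funext w
    simp only [Function.comp_apply, Equiv.swap_apply_left, Equiv.swap_apply_right]
    congr 1
    ext i' : 1
    rcases eq_or_ne i' last with rfl | hi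
    · simp
    · have hfix : ∀ j, Equiv.swap (slot (k := fun _ => 2) hN last 0)
          (slot (k := fun _ => 2) hN last 1) (slot (k := fun _ => 2) hN i' j) =
          slot (k := fun _ => 2) hN i' j := fun j =>
        Equiv.swap_apply_of_ne_of_ne
          (fun h => hi (congrArg Sigma.fst (slot_injective hN h)))
          (fun h => hi (congrArg Sigma.fst (slot_injective hN h)))
      simp only [Function.update_of_ne hi, hfix]
  have hi : ∀ i ∈ (Finset.univ : Finset (Fin l)), altSum (fun w => P.toMultilinearMap
      (Function.update (fun i' => localCurv A y
        ![w (slot (k := fun _ => 2) hN i' 0), w (slot (k := fun _ => 2) hN i' 1)]) i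
      (covDeriv A b y (w (slot (k := fun _ => 2) hN i 0)) ![w (slot (k := fun _ => 2) hN i 1)] -
        covDeriv A b y (w (slot (k := fun _ => 2) hN i 1)) ![w (slot (k := fun _ => 2) hN i 0)])))
        v = (2 : ℝ) • S := fun i _ => by
    have h := altSum_update_perm P (fun u v => localCurv A y ![u, v])
      (fun u v => covDeriv A b y u ![v] - covDeriv A b y v ![u]) hN (Equiv.swap last i) last v
    rw [Equiv.swap_apply_left] at h
    rw [h]
    simp only [MultilinearMap.map_update_sub]
    rw [altSum_sub, hswap, sub_neg_eq_add, two_smul]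
  -- The normalizations match: `l * 2 / 2 ^ l = l / 2 ^ (l - 1)`.
  rw [Finset.sum_congr rfl hi, Finset.sum_const, Finset.card_univ, Fintype.card_fin,
    ← Nat.cast_smul_eq_nsmul ℝ, smul_smul, smul_smul, smul_smul]
  congr 1
  have h2 : (2 ^ l : ℕ) = 2 ^ (l - 1) * 2 := by rw [← pow_succ]; congr 1; omega
  rw [h2]
  push_cast
  field_simp

end transgression

/-! ### Gauge transformations -/

section gauge

open scoped Matrix.Norms.Operator

/-- The algebra behind the transformation of the curvature: `h` is the gauge transformation with
inverse `k`, `hu, hv` are its derivatives, `huv` its second derivative, `p, q` the values and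
`puv, pvu` the derivatives of the connection. -/
lemma gauge_identity {R : Type*} [Ring R] {h k : R} (hkh : k * h = 1)
    (hu hv huv p q puv pvu : R) :
    (hu * q * k + h * puv * k + h * q * (-(k * hu * k)) - (huv * k + hv * (-(k * hu * k))))
      - (hv * p * k + h * pvu * k + h * p * (-(k * hv * k)) - (huv * k + hu * (-(k * hv * k))))
      + ((h * p * k - hu * k) * (h * q * k - hv * k) - (h * q * k - hv * k) * (h * p * k - hu * k))
    = h * (puv - pvu + (p * q - q * p)) * k := by
  have key : ∀ x z : R, x * k * (h * z) = x * z := fun x z => by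
    rw [mul_assoc, ← mul_assoc k, hkh, one_mul]
  have e : ∀ p q hu hv : R, (h * p * k - hu * k) * (h * q * k - hv * k) =
      h * p * q * k - h * p * k * hv * k - hu * q * k + hu * k * hv * k := fun p q hu hv => by
    rw [sub_mul, mul_sub, mul_sub, ← mul_assoc, key, ← mul_assoc, ← mul_assoc (hu * k) (h * q), key,
      ← mul_assoc]
    abel
  rw [e, e]
  noncomm_ring

/-- The derivative of `h p h⁻¹ - q h⁻¹`; here `k` stands for `h⁻¹` and `q` for a derivative of `h`. -/
lemma hasFDerivAt_gauge_apply {R E : Type*} [NormedRing R] [NormedAlgebra ℝ R]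
    [NormedAddCommGroup E] [NormedSpace ℝ E] {h k p q f : E → R} {h' k' p' q' f' : E →L[ℝ] R} {y : E}
    (hh : HasFDerivAt h h' y) (hk : HasFDerivAt k k' y) (hp : HasFDerivAt p p' y)
    (hq : HasFDerivAt q q' y) (hf : HasFDerivAt f f' y)
    (he : f =ᶠ[𝓝 y] fun z => h z * p z * k z - q z * k z)
    (hk' : ∀ u, k' u = -(k y * h' u * k y)) (u : E) :
    f' u = h' u * p y * k y + h y * p' u * k y + h y * p y * (-(k y * h' u * k y))
      - (q' u * k y + q y * (-(k y * h' u * k y))) := by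
  have h1 := (((hh.mul' hp).mul' hk).sub (hq.mul' hk)).congr_of_eventuallyEq he
  rw [hf.unique h1]
  simp [hk']
  noncomm_ring

variable {n : ℕ} {𝕜 : Type*} [RCLike 𝕜] {G : Subgroup (GL (Fin n) 𝕜)}
  {E : Type*} [NormedAddCommGroup E] [NormedSpace ℝ E]

/-- Under a gauge transformation, the curvature transforms by the adjoint action. -/
lemma localCurv_gauge {a a' : E → E [⋀^Fin 1]→L[ℝ] LieAlg G} {γ : E → G} {s : Set E}
    (hs : IsOpen s) (ha : ContDiffOn ℝ ∞ a s) (ha' : ContDiffOn ℝ ∞ a' s)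
    (hγ : ∀ i j, ContDiffOn ℝ ∞ (fun z => toMat (γ z) i j) s)
    (htr : ∀ z ∈ s, ∀ v, (a' z ![v]).val = toMat (γ z) * (a z ![v]).val * toMat (γ z)⁻¹ -
      (Matrix.of fun i j => fderiv ℝ (fun z => toMat (γ z) i j) z v) * toMat (γ z)⁻¹)
    {y : E} (hy : y ∈ s) (u v : E) :
    localCurv a' y ![u, v] = Ad (γ y) (localCurv a y ![u, v]) := by
  have hda : DifferentiableAt ℝ a y := (ha.contDiffAt (hs.mem_nhds hy)).differentiableAt (by simp)
  have hda' : DifferentiableAt ℝ a' y :=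
    (ha'.contDiffAt (hs.mem_nhds hy)).differentiableAt (by simp)
  let h : E → Matrix (Fin n) (Fin n) 𝕜 := fun z => toMat (γ z)
  have hh : ContDiffOn ℝ ∞ h s := (ofEntriesL n 𝕜).contDiff.comp_contDiffOn
    (contDiffOn_pi.2 fun i => contDiffOn_pi.2 fun j => hγ i j)
  have hhy : ContDiffAt ℝ ∞ h y := hh.contDiffAt (hs.mem_nhds hy)
  have hfd : ∀ z ∈ s, ∀ v, (Matrix.of fun i j => fderiv ℝ (fun z => toMat (γ z) i j) z v) =
      fderiv ℝ h z v := fun z hz v => by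
    have h1 : HasFDerivAt (fun z i j => toMat (γ z) i j) (ContinuousLinearMap.pi fun i =>
        ContinuousLinearMap.pi fun j => fderiv ℝ (fun z => toMat (γ z) i j) z) z :=
      hasFDerivAt_pi.2 fun i => hasFDerivAt_pi.2 fun j =>
        (((hγ i j).contDiffAt (hs.mem_nhds hz)).differentiableAt (by simp)).hasFDerivAt
    have h2 : HasFDerivAt h _ z := (ofEntriesL n 𝕜).hasFDerivAt.comp z h1
    rw [h2.fderiv]
    rfl
  have hdh : HasFDerivAt h (fderiv ℝ h y) y := (hhy.differentiableAt (by simp)).hasFDerivAt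
  have hdk : HasFDerivAt (fun z => toMat (γ z)⁻¹)
      ((-(ContinuousLinearMap.mulLeftRight ℝ (Matrix (Fin n) (Fin n) 𝕜)) (toMat (γ y)⁻¹)
        (toMat (γ y)⁻¹)).comp (fderiv ℝ h y)) y :=
    (HasFDerivAt.comp (g := Ring.inverse) (f := h) y
      (hasFDerivAt_ringInverse (𝕜 := ℝ) (γ y : GL (Fin n) 𝕜)) hdh).congr_of_eventuallyEq
      (.of_forall fun z => (ringInverse_toMat (γ z)).symm)
  have hddh : DifferentiableAt ℝ (fderiv ℝ h) y :=
    (hhy.fderiv_right (m := 1) (by norm_cast)).differentiableAt (by simp)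
  have hsymm : fderiv ℝ (fderiv ℝ h) y v u = fderiv ℝ (fderiv ℝ h) y u v :=
    (hhy.isSymmSndFDerivAt (by simpa using ENat.LEInfty.out)).eq v u
  have hD : ∀ v, HasFDerivAt (fun z => fderiv ℝ h z v) ((fderiv ℝ (fderiv ℝ h) y).flip v) y :=
    fun v => hasFDerivAt_fderiv_apply hddh v
  have hval : ∀ {b : E → E [⋀^Fin 1]→L[ℝ] LieAlg G}, DifferentiableAt ℝ b y → ∀ v,
      HasFDerivAt (fun z => (b z ![v]).val)
        ((valL G).comp ((ContinuousAlternatingMap.apply ℝ E (LieAlg G) ![v]).comp (fderiv ℝ b y))) y :=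
    fun hb v => (valL G).hasFDerivAt.comp y (hasFDerivAt_apply_tuple hb.hasFDerivAt ![v])
  have hder : ∀ u v, (fderiv ℝ a' y u ![v]).val =
      fderiv ℝ h y u * (a y ![v]).val * toMat (γ y)⁻¹
      + h y * (fderiv ℝ a y u ![v]).val * toMat (γ y)⁻¹
      + h y * (a y ![v]).val * (-(toMat (γ y)⁻¹ * fderiv ℝ h y u * toMat (γ y)⁻¹))
      - (fderiv ℝ (fderiv ℝ h) y u v * toMat (γ y)⁻¹
        + fderiv ℝ h y v * (-(toMat (γ y)⁻¹ * fderiv ℝ h y u * toMat (γ y)⁻¹))) := fun u v => by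
    refine hasFDerivAt_gauge_apply hdh hdk (hval hda v) (hD v) (hval hda' v) ?_ (fun u => ?_) u
    · filter_upwards [hs.mem_nhds hy] with z hz
      rw [htr z hz, hfd z hz]
    · rfl
  have hkh : toMat (γ y)⁻¹ * h y = 1 := by simp [h, toMat]
  apply LieAlg.val_injective
  rw [val_Ad, localCurv_apply, localCurv_apply, map_add, map_sub, map_add, map_sub, val_bracketL,
    val_bracketL, hder, hder, htr y hy, htr y hy, hfd y hy, hfd y hy, hsymm]
  exact gauge_identity hkh _ _ _ _ _ _ _

/-- A wedge product formed with an invariant polynomial does not change when all its factors are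
moved by the same element of `G`. -/
lemma multiWedge_Ad {T : Type*} [AddCommGroup T] [Module ℝ T] [TopologicalSpace T] {l : ℕ}
    (P : AdInvariantPolynomial G l) (g : G) {k : Fin l → ℕ} {N : ℕ} (hN : ∑ i, k i = N)
    {θ θ' : (i : Fin l) → T [⋀^Fin (k i)]→L[ℝ] LieAlg G}
    (h : ∀ i w, θ' i w = Ad g (θ i w)) :
    multiWedge P.toMultilinearMap hN θ' = multiWedge P.toMultilinearMap hN θ := by
  ext v
  simp only [multiWedge_eq_altSum, h, P.map_ad]

end gauge

/-! ### Differential forms in charts -/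

section charts

/-- The part of the target of the chart `e` that corresponds to `s`. -/
def chartSet {E M : Type*} [TopologicalSpace E] [TopologicalSpace M]
    (e : OpenPartialHomeomorph M E) (s : Set M) : Set E := e.target ∩ e.symm ⁻¹' s

lemma isOpen_chartSet {E M : Type*} [TopologicalSpace E] [TopologicalSpace M]
    (e : OpenPartialHomeomorph M E) {s : Set M} (hs : IsOpen s) : IsOpen (chartSet e s) :=
  e.symm.isOpen_inter_preimage hs

lemma exists_chart_point (E : Type*) {M : Type*} [TopologicalSpace E] [TopologicalSpace M]
    [ChartedSpace E M] (x : M) {s : Set M} (hx : x ∈ s) :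
    ∃ e ∈ atlas E M, ∃ y ∈ chartSet e s, e.symm y = x :=
  ⟨chartAt E x, chart_mem_atlas E x, chartAt E x x,
    ⟨mem_chart_target E x, by
      rwa [Set.mem_preimage, (chartAt E x).left_inv (mem_chart_source E x)]⟩,
    (chartAt E x).left_inv (mem_chart_source E x)⟩

lemma mdifferentiable_chart {E M : Type*} [NormedAddCommGroup E] [NormedSpace ℝ E]
    [TopologicalSpace M] [ChartedSpace E M] [IsManifold 𝓘(ℝ, E) ∞ M]
    {e : OpenPartialHomeomorph M E} (he : e ∈ atlas E M) : e.MDifferentiable 𝓘(ℝ, E) 𝓘(ℝ, E) :=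
  have : IsManifold 𝓘(ℝ, E) 1 M := IsManifold.of_le (n := ∞) (by simp)
  mdifferentiable_of_mem_atlas he

variable {E : Type*} [NormedAddCommGroup E] [NormedSpace ℝ E] {M : Type*} [TopologicalSpace M]
  [ChartedSpace E M] {k : ℕ} {V : Type*} [NormedAddCommGroup V] [NormedSpace ℝ V]

namespace DiffForm

lemma inChart_apply (θ : DiffForm E M k V) (e : OpenPartialHomeomorph M E) (y : E) (v : Fin k → E) :
    θ.inChart e y v = θ (e.symm y) fun i => mfderiv 𝓘(ℝ, E) 𝓘(ℝ, E) e.symm y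
      ((NormedSpace.fromTangentSpace (𝕜 := ℝ) y).symm (v i)) := rfl

lemma inChart_add (θ θ' : DiffForm E M k V) (e : OpenPartialHomeomorph M E) :
    (θ + θ').inChart e = θ.inChart e + θ'.inChart e := rfl

lemma inChart_sub (θ θ' : DiffForm E M k V) (e : OpenPartialHomeomorph M E) :
    (θ - θ').inChart e = θ.inChart e - θ'.inChart e := rfl

lemma inChart_smul (r : ℝ) (θ : DiffForm E M k V) (e : OpenPartialHomeomorph M E) :
    (r • θ).inChart e = r • θ.inChart e := rfl

lemma SmoothOn.congr {θ θ' : DiffForm E M k V} {s : Set M} (h : θ.SmoothOn s)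
    (hθ : ∀ x ∈ s, θ' x = θ x) : θ'.SmoothOn s := fun e he =>
  (h e he).congr fun y hy => by rw [inChart, hθ _ hy.2]; rfl

lemma smoothOn_univ_of_cover {ι : Type*} {U : ι → Set M} (hU : ∀ α, IsOpen (U α))
    (hcover : ∀ x, ∃ α, x ∈ U α) {θ : DiffForm E M k V} (h : ∀ α, θ.SmoothOn (U α)) :
    θ.SmoothOn Set.univ := fun e he y hy => by
  obtain ⟨α, hα⟩ := hcover (e.symm y)
  exact (((h α) e he).contDiffAt ((isOpen_chartSet e (hU α)).mem_nhds ⟨hy.1, hα⟩)).contDiffWithinAt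

variable [IsManifold 𝓘(ℝ, E) ∞ M]

lemma exists_eq_mfderiv_symm {e : OpenPartialHomeomorph M E} (he : e ∈ atlas E M) {y : E}
    (hy : y ∈ e.target) (v : Fin k → TangentSpace 𝓘(ℝ, E) (e.symm y)) :
    ∃ w : Fin k → E, (fun i => mfderiv 𝓘(ℝ, E) 𝓘(ℝ, E) e.symm y
      ((NormedSpace.fromTangentSpace (𝕜 := ℝ) y).symm (w i))) = v := by
  choose w hw using fun i => (mdifferentiable_chart he).symm.mfderiv_surjective hy (v i)
  exact ⟨fun i => NormedSpace.fromTangentSpace (𝕜 := ℝ) y (w i), funext fun i => hw i⟩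

/-- A form is determined at a point by its expression in a chart. -/
lemma eq_of_inChart_eq {θ θ' : DiffForm E M k V} {e : OpenPartialHomeomorph M E}
    (he : e ∈ atlas E M) {y : E} (hy : y ∈ e.target) (h : θ.inChart e y = θ'.inChart e y) :
    θ (e.symm y) = θ' (e.symm y) := by
  ext v
  obtain ⟨w, rfl⟩ := exists_eq_mfderiv_symm he hy v
  exact DFunLike.congr_fun h w

/-- Each alternating map on `E` is the expression, at a point of a chart, of an alternating map on the
tangent space of `M`. -/
lemma exists_of_inChart {e : OpenPartialHomeomorph M E} (he : e ∈ atlas E M) {y : E}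
    (hy : y ∈ e.target) (a : E [⋀^Fin k]→L[ℝ] V) :
    ∃ b : TangentSpace 𝓘(ℝ, E) (e.symm y) [⋀^Fin k]→L[ℝ] V, ∀ w : Fin k → E,
      (b fun i => mfderiv 𝓘(ℝ, E) 𝓘(ℝ, E) e.symm y
        ((NormedSpace.fromTangentSpace (𝕜 := ℝ) y).symm (w i))) = a w := by
  let f := (mdifferentiable_chart he).symm.mfderiv hy
  refine ⟨a.compContinuousLinearMap ((NormedSpace.fromTangentSpace (𝕜 := ℝ) y).toContinuousLinearMap.comp
    f.symm.toContinuousLinearMap), fun w => ?_⟩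
  refine congrArg a (funext fun i => ?_)
  have h : f.symm (f ((NormedSpace.fromTangentSpace (𝕜 := ℝ) y).symm (w i))) =
    (NormedSpace.fromTangentSpace (𝕜 := ℝ) y).symm (w i) := f.symm_apply_apply _
  exact (congrArg (NormedSpace.fromTangentSpace (𝕜 := ℝ) y) h).trans
    ((NormedSpace.fromTangentSpace (𝕜 := ℝ) y).apply_symm_apply _)

lemma contDiffAt_transition {e c : OpenPartialHomeomorph M E} (he : e ∈ atlas E M)
    (hc : c ∈ atlas E M) {y : E} (hy : y ∈ e.target) (hyc : e.symm y ∈ c.source) :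
    ContDiffAt ℝ ∞ (c ∘ e.symm) y := by
  rw [← contMDiffAt_iff_contDiffAt]
  have h1 := (contMDiffOn_of_mem_maximalAtlas (I := 𝓘(ℝ, E)) (n := ∞)
    (IsManifold.subset_maximalAtlas hc)).contMDiffAt (c.open_source.mem_nhds hyc)
  have h2 := (contMDiffOn_symm_of_mem_maximalAtlas (I := 𝓘(ℝ, E)) (n := ∞)
    (IsManifold.subset_maximalAtlas he)).contMDiffAt (e.open_target.mem_nhds hy)
  exact ContMDiffAt.comp y h1 h2

lemma mfderiv_chart_comp {e c : OpenPartialHomeomorph M E} (he : e ∈ atlas E M)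
    (hc : c ∈ atlas E M) {y : E} (hy : y ∈ e.target) (hyc : e.symm y ∈ c.source) (v : E) :
    (mfderiv 𝓘(ℝ, E) 𝓘(ℝ, E) c (e.symm y) (mfderiv 𝓘(ℝ, E) 𝓘(ℝ, E) e.symm y v) : E) =
      fderiv ℝ (c ∘ e.symm) y v := by
  have h := mfderiv_comp y ((mdifferentiable_chart hc).mdifferentiableAt hyc)
    ((mdifferentiable_chart he).symm.mdifferentiableAt hy)
  rw [mfderiv_eq_fderiv] at h
  exact (DFunLike.congr_fun h v).symm

lemma inChart_eq_pullback (θ : DiffForm E M k V) {e c : OpenPartialHomeomorph M E}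
    (he : e ∈ atlas E M) (hc : c ∈ atlas E M) {y : E} (hy : y ∈ e.target)
    (hyc : e.symm y ∈ c.source) :
    θ.inChart e y =
      (θ.inChart c ((c ∘ e.symm) y)).compContinuousLinearMap (fderiv ℝ (c ∘ e.symm) y) := by
  have hpt : c.symm ((c ∘ e.symm) y) = e.symm y := c.left_inv hyc
  have hev : e.symm =ᶠ[𝓝 y] c.symm ∘ (c ∘ e.symm) := by
    filter_upwards [(isOpen_chartSet e c.open_source).mem_nhds ⟨hy, hyc⟩] with z hz
    exact (c.left_inv hz.2).symm
  have hφ := contDiffAt_transition he hc hy hyc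
  have hm : ∀ v : E, (mfderiv 𝓘(ℝ, E) 𝓘(ℝ, E) e.symm y v : E) =
      mfderiv 𝓘(ℝ, E) 𝓘(ℝ, E) c.symm ((c ∘ e.symm) y) (fderiv ℝ (c ∘ e.symm) y v) := fun v => by
    have h1 := hev.mfderiv_eq (I := 𝓘(ℝ, E)) (I' := 𝓘(ℝ, E))
    have h2 := mfderiv_comp y (I := 𝓘(ℝ, E)) (I' := 𝓘(ℝ, E)) (I'' := 𝓘(ℝ, E))
      ((mdifferentiable_chart hc).symm.mdifferentiableAt
      (show (c ∘ e.symm) y ∈ c.symm.source from c.map_source hyc))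
      (hφ.differentiableAt (by simp)).mdifferentiableAt
    rw [mfderiv_eq_fderiv] at h2
    exact DFunLike.congr_fun (h1.trans h2) v
  have hθ : ∀ (x x' : M) (_ : x = x') (w : Fin k → E),
      (θ x : E [⋀^Fin k]→L[ℝ] V) w = (θ x' : E [⋀^Fin k]→L[ℝ] V) w := fun x x' h w => by rw [h]
  ext v
  rw [inChart_apply, ContinuousAlternatingMap.compContinuousLinearMap_apply, inChart_apply]
  refine Eq.trans ?_ (hθ _ _ hpt.symm _)
  exact congrArg (θ (e.symm y)) (funext fun i => hm (v i))

/-- The exterior derivative on `M` is computed by the exterior derivative in any chart. -/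
lemma SmoothOn.inChart_d {θ : DiffForm E M k V} {s : Set M} (hs : IsOpen s) (hθ : θ.SmoothOn s)
    {e : OpenPartialHomeomorph M E} (he : e ∈ atlas E M) {y : E} (hy : y ∈ chartSet e s) :
    θ.d.inChart e y = extDeriv (θ.inChart e) y := by
  set c := chartAt E (e.symm y) with hcdef
  have hc : c ∈ atlas E M := chart_mem_atlas E _
  have hyc : e.symm y ∈ c.source := mem_chart_source E _
  have hev : θ.inChart e =ᶠ[𝓝 y] fun z =>
      (θ.inChart c ((c ∘ e.symm) z)).compContinuousLinearMap (fderiv ℝ (c ∘ e.symm) z) := by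
    filter_upwards [(isOpen_chartSet e c.open_source).mem_nhds ⟨hy.1, hyc⟩] with z hz
    exact inChart_eq_pullback θ he hc hz.1 hz.2
  have hd : DifferentiableAt ℝ (θ.inChart c) ((c ∘ e.symm) y) := by
    refine ((hθ c hc).contDiffAt ((isOpen_chartSet c hs).mem_nhds
      ⟨c.map_source hyc, ?_⟩)).differentiableAt (by simp)
    rw [Set.mem_preimage, c.left_inv hyc]
    exact hy.2
  rw [hev.extDeriv_eq, extDeriv_pullback hd (contDiffAt_transition he hc hy.1 hyc)
    (by simpa using ENat.LEInfty.out)]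
  ext v
  refine congrArg (extDeriv (θ.inChart c) (c (e.symm y))) (funext fun i => ?_)
  exact mfderiv_chart_comp he hc hy.1 hyc (v i)

end DiffForm

end charts

/-! ### Curvature and invariant polynomials on a manifold -/

section manifold

variable {n : ℕ} {𝕜 : Type*} [RCLike 𝕜] {G : Subgroup (GL (Fin n) 𝕜)}
  {E : Type*} [NormedAddCommGroup E] [NormedSpace ℝ E] {M : Type*} [TopologicalSpace M]
  [ChartedSpace E M] {l : ℕ}

lemma inChart_evalForm (P : AdInvariantPolynomial G l) (F : DiffForm E M 2 (LieAlg G))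
    (e : OpenPartialHomeomorph M E) (y : E) :
    (P.evalForm F).inChart e y = evalPow P (F.inChart e y) :=
  multiWedge_comp _ _ _ _

lemma inChart_evalFormLast (P : AdInvariantPolynomial G l) (F : DiffForm E M 2 (LieAlg G))
    (B : DiffForm E M 1 (LieAlg G)) (e : OpenPartialHomeomorph M E) (y : E) :
    (P.evalFormLast F B).inChart e y = evalPowLast P (F.inChart e y) (B.inChart e y) := by
  refine (multiWedge_comp _ _ _ _).trans ?_
  unfold evalPowLast
  congr 1
  funext i
  by_cases h : (i : ℕ) + 1 = l
  · simp only [dif_pos h]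
    rfl
  · simp only [dif_neg h]
    rfl

lemma DiffForm.SmoothOn.add {k : ℕ} {V : Type*} [NormedAddCommGroup V] [NormedSpace ℝ V]
    {θ θ' : DiffForm E M k V} {s : Set M} (h : θ.SmoothOn s) (h' : θ'.SmoothOn s) :
    (θ + θ').SmoothOn s := fun e he => (h e he).add (h' e he)

lemma DiffForm.SmoothOn.sub {k : ℕ} {V : Type*} [NormedAddCommGroup V] [NormedSpace ℝ V]
    {θ θ' : DiffForm E M k V} {s : Set M} (h : θ.SmoothOn s) (h' : θ'.SmoothOn s) :
    (θ - θ').SmoothOn s := fun e he => (h e he).sub (h' e he)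

lemma DiffForm.SmoothOn.const_smul {k : ℕ} {V : Type*} [NormedAddCommGroup V] [NormedSpace ℝ V]
    {θ : DiffForm E M k V} {s : Set M} (r : ℝ) (h : θ.SmoothOn s) :
    (r • θ).SmoothOn s := fun e he => (h e he).const_smul r

lemma DiffForm.SmoothOn.mono {k : ℕ} {V : Type*} [NormedAddCommGroup V] [NormedSpace ℝ V]
    {θ : DiffForm E M k V} {s s' : Set M} (h : θ.SmoothOn s) (hs : s' ⊆ s) :
    θ.SmoothOn s' := fun e he => (h e he).mono fun _ hy => ⟨hy.1, hs hy.2⟩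

/-- The forms `A` and `A'` are related on `s` by the gauge transformation `g`. -/
def GaugeRelated (g : M → G) (s : Set M) (A A' : DiffForm E M 1 (LieAlg G)) : Prop :=
  ∀ x ∈ s, ∀ v : TangentSpace 𝓘(ℝ, E) x,
    (A' x ![v]).val = toMat (g x) * (A x ![v]).val * toMat (g x)⁻¹
      - Matrix.of (fun i j => NormedSpace.fromTangentSpace (𝕜 := ℝ) _
        (mfderiv 𝓘(ℝ, E) 𝓘(ℝ, 𝕜) (fun y => toMat (g y) i j) x v)) * toMat (g x)⁻¹

variable {ι : Type*} {Q : PrincipalBundle G E M ι}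

lemma Connection.gaugeRelated (A : Connection Q) (α β : ι) :
    GaugeRelated (Q.g α β) (Q.U α ∩ Q.U β) (A.A α) (A.A β) :=
  A.transform α β

lemma Connection.gaugeRelated_segment (A₀ A₁ : Connection Q) (α β : ι) (t : ℝ) :
    GaugeRelated (Q.g α β) (Q.U α ∩ Q.U β) (A₀.A α + t • (A₁.A α - A₀.A α))
      (A₀.A β + t • (A₁.A β - A₀.A β)) := by
  intro x hx v
  have h0 := A₀.transform α β x hx v
  have h1 := A₁.transform α β x hx v
  have hS : ∀ a b : DiffForm E M 1 (LieAlg G), ((a + t • (b - a)) x ![v]).val =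
      (a x ![v]).val + t • ((b x ![v]).val - (a x ![v]).val) := fun a b => by
    rw [Pi.add_apply, Pi.smul_apply, Pi.sub_apply, ContinuousAlternatingMap.add_apply,
      ContinuousAlternatingMap.smul_apply, ContinuousAlternatingMap.sub_apply, map_add, map_smul,
      map_sub]
  rw [hS, hS, h0, h1, mul_add, add_mul, mul_smul_comm, smul_mul_assoc, mul_sub, sub_mul,
    PrincipalBundle.dg]
  module

variable [IsManifold 𝓘(ℝ, E) ∞ M]

lemma inChart_curvature {A : DiffForm E M 1 (LieAlg G)} {s : Set M} (hs : IsOpen s)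
    (hA : A.SmoothOn s) {e : OpenPartialHomeomorph M E} (he : e ∈ atlas E M) {y : E}
    (hy : y ∈ chartSet e s) : (curvature A).inChart e y = localCurv (A.inChart e) y := by
  have hb : (bracketForm A A).inChart e y = multiWedge (lieBracket G) (k := fun _ => 1) (by simp)
      ![A.inChart e y, A.inChart e y] := by
    refine (multiWedge_comp _ _ _ _).trans ?_
    congr 1
    funext i
    fin_cases i <;> rfl
  rw [curvature, DiffForm.inChart_add, DiffForm.inChart_smul, Pi.add_apply, Pi.smul_apply, hb,
    hA.inChart_d hs he hy, localCurv]

lemma smoothOn_evalForm_curvature (P : AdInvariantPolynomial G l) {A : DiffForm E M 1 (LieAlg G)}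
    {s : Set M} (hs : IsOpen s) (hA : A.SmoothOn s) : (P.evalForm (curvature A)).SmoothOn s :=
  fun e he => (ContDiffOn.multiWedge P.toMultilinearMap (k := fun _ => 2) (by simp [mul_comm])
    fun _ => contDiffOn_localCurv (isOpen_chartSet e hs) (hA e he)).congr fun y hy => by
      rw [inChart_evalForm, inChart_curvature hs hA he hy]
      rfl

/-- The curvatures of gauge related connections are related by the adjoint action. -/
lemma GaugeRelated.curvature_eq {g : M → G} {s : Set M} (hs : IsOpen s)
    (hg : ∀ i j, ContMDiffOn 𝓘(ℝ, E) 𝓘(ℝ, 𝕜) ∞ (fun x => toMat (g x) i j) s)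
    {A A' : DiffForm E M 1 (LieAlg G)} (hA : A.SmoothOn s) (hA' : A'.SmoothOn s)
    (h : GaugeRelated g s A A') {x : M} (hx : x ∈ s) (w : Fin 2 → TangentSpace 𝓘(ℝ, E) x) :
    curvature A' x w = Ad (g x) (curvature A x w) := by
  obtain ⟨e, he, y, hy, rfl⟩ := exists_chart_point E x hx
  obtain ⟨w, rfl⟩ := DiffForm.exists_eq_mfderiv_symm he hy.1 w
  rw [← DiffForm.inChart_apply, ← DiffForm.inChart_apply, inChart_curvature hs hA he hy,
    inChart_curvature hs hA' he hy]
  have hmd : ∀ z ∈ chartSet e s, ContMDiffAt 𝓘(ℝ, E) 𝓘(ℝ, E) ∞ e.symm z := fun z hz =>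
    (contMDiffOn_symm_of_mem_maximalAtlas (I := 𝓘(ℝ, E)) (n := ∞)
      (IsManifold.subset_maximalAtlas he)).contMDiffAt (e.open_target.mem_nhds hz.1)
  have hw : w = ![w 0, w 1] := by ext j; fin_cases j <;> rfl
  rw [hw]
  refine localCurv_gauge (γ := g ∘ e.symm) (isOpen_chartSet e hs) (hA e he) (hA' e he)
    (fun i j z hz => ?_) (fun z hz v => ?_) hy _ _
  · have h1 := ((hg i j).contMDiffAt (hs.mem_nhds hz.2)).comp z (hmd z hz)
    exact (contMDiffAt_iff_contDiffAt.1 h1).contDiffWithinAt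
  · have h1 := h (e.symm z) hz.2 (mfderiv 𝓘(ℝ, E) 𝓘(ℝ, E) e.symm z
      ((NormedSpace.fromTangentSpace (𝕜 := ℝ) z).symm v))
    have hB : ∀ B : DiffForm E M 1 (LieAlg G), B.inChart e z ![v] =
        B (e.symm z) ![mfderiv 𝓘(ℝ, E) 𝓘(ℝ, E) e.symm z
          ((NormedSpace.fromTangentSpace (𝕜 := ℝ) z).symm v)] := fun B => by
      rw [DiffForm.inChart_apply]
      exact congrArg (B (e.symm z)) (funext fun j => by fin_cases j; rfl)
    rw [hB, hB, h1]
    congr 2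
    ext i j
    have h2 := mfderiv_comp z (((hg i j).contMDiffAt (hs.mem_nhds hz.2)).mdifferentiableAt (by simp))
      ((hmd z hz).mdifferentiableAt (by simp))
    rw [mfderiv_eq_fderiv] at h2
    exact (DFunLike.congr_fun h2 v).symm

/-- The local forms `P(F)` agree on overlaps. -/
lemma evalForm_curvature_eq (P : AdInvariantPolynomial G l) (A : Connection Q) {α β : ι} {x : M}
    (hα : x ∈ Q.U α) (hβ : x ∈ Q.U β) :
    P.evalForm (curvature (A.A β)) x = P.evalForm (curvature (A.A α)) x :=
  multiWedge_Ad P (Q.g α β x) _ fun _ w =>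
    (A.gaugeRelated α β).curvature_eq ((Q.isOpen_U α).inter (Q.isOpen_U β)) (Q.smooth_g α β)
      ((A.smooth_A α).mono Set.inter_subset_left) ((A.smooth_A β).mono Set.inter_subset_right)
      ⟨hα, hβ⟩ w

/-- The local transgression integrands agree on overlaps. -/
lemma evalFormLast_curvature_eq (P : AdInvariantPolynomial G l) (A₀ A₁ : Connection Q) (t : ℝ)
    {α β : ι} {x : M} (hα : x ∈ Q.U α) (hβ : x ∈ Q.U β) :
    P.evalFormLast (curvature (A₀.A β + t • (A₁.A β - A₀.A β))) (A₁.A β - A₀.A β) x =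
      P.evalFormLast (curvature (A₀.A α + t • (A₁.A α - A₀.A α))) (A₁.A α - A₀.A α) x := by
  have hsm : ∀ α, (A₀.A α + t • (A₁.A α - A₀.A α)).SmoothOn (Q.U α) := fun α =>
    (A₀.smooth_A α).add (((A₁.smooth_A α).sub (A₀.smooth_A α)).const_smul t)
  refine multiWedge_Ad P (Q.g α β x) _ fun i w => ?_
  by_cases h : (i : ℕ) + 1 = l
  · simp only [dif_pos h, castAlternating_apply]
    have hw : ∀ w : Fin 1 → TangentSpace 𝓘(ℝ, E) x, (A₁.A β - A₀.A β) x w =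
        Ad (Q.g α β x) ((A₁.A α - A₀.A α) x w) := fun w => by
      have hw1 : w = ![w 0] := by ext j; fin_cases j; rfl
      apply LieAlg.val_injective
      rw [hw1, val_Ad, Pi.sub_apply, Pi.sub_apply, ContinuousAlternatingMap.sub_apply,
        ContinuousAlternatingMap.sub_apply, map_sub, map_sub, A₀.transform α β x ⟨hα, hβ⟩,
        A₁.transform α β x ⟨hα, hβ⟩, mul_sub, sub_mul]
      abel
    exact hw _
  · simp only [dif_neg h, castAlternating_apply]
    exact (A₀.gaugeRelated_segment A₁ α β t).curvature_eq ((Q.isOpen_U α).inter (Q.isOpen_U β))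
      (Q.smooth_g α β) ((hsm α).mono Set.inter_subset_left) ((hsm β).mono Set.inter_subset_right)
      ⟨hα, hβ⟩ _

end manifold

/-! ### Chern–Weil forms and transgression forms -/

section main

variable {n : ℕ} {𝕜 : Type*} [RCLike 𝕜] {G : Subgroup (GL (Fin n) 𝕜)}
  {E : Type*} [NormedAddCommGroup E] [NormedSpace ℝ E] {M : Type*} [TopologicalSpace M]
  [ChartedSpace E M] {ι : Type*} {Q : PrincipalBundle G E M ι} {l : ℕ}

/-- An invariant polynomial of degree `0` is a constant, whatever the connection. -/
lemma IsChernWeilForm.eq_of_degree_zero {P : AdInvariantPolynomial G l} {A₀ A₁ : Connection Q}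
    {θ₀ θ₁ : DiffForm E M (2 * l) ℂ} (h₀ : IsChernWeilForm P A₀ θ₀) (h₁ : IsChernWeilForm P A₁ θ₁)
    (hl : l = 0) : θ₁ = θ₀ := by
  subst hl
  funext x
  obtain ⟨α, hα⟩ := Q.cover x
  rw [h₀.2 α x hα, h₁.2 α x hα]
  exact congrArg (multiWedge P.toMultilinearMap (k := fun _ => 2) _) (funext fun i => i.elim0)

lemma IsTransgressionForm.inChart_apply_eq {P : AdInvariantPolynomial G l} {A₀ A₁ : Connection Q}
    {η : DiffForm E M (2 * l - 1) ℂ} (h : IsTransgressionForm P A₀ A₁ η) {α : ι}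
    {e : OpenPartialHomeomorph M E} {y : E} (hy : y ∈ chartSet e (Q.U α))
    (v : Fin (2 * l - 1) → E) :
    η.inChart e y v = (l : ℂ) * ∫ t in (0 : ℝ)..1,
      (P.evalFormLast (curvature (A₀.A α + t • (A₁.A α - A₀.A α)))
        (A₁.A α - A₀.A α)).inChart e y v := by
  rw [DiffForm.inChart_apply, h.2 α _ hy.2]
  rfl

variable [IsManifold 𝓘(ℝ, E) ∞ M]

lemma existsUnique_isChernWeilForm (P : AdInvariantPolynomial G l) (A : Connection Q) :
    ∃! θ, IsChernWeilForm P A θ := by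
  choose α hα using Q.cover
  have h : ∀ β, ∀ x ∈ Q.U β, P.evalForm (curvature (A.A (α x))) x =
      P.evalForm (curvature (A.A β)) x := fun β x hx => evalForm_curvature_eq P A hx (hα x)
  refine ⟨fun x => P.evalForm (curvature (A.A (α x))) x, ⟨?_, h⟩, fun θ hθ =>
    funext fun x => hθ.2 _ _ (hα x)⟩
  exact DiffForm.smoothOn_univ_of_cover Q.isOpen_U Q.cover fun β =>
    (smoothOn_evalForm_curvature P (Q.isOpen_U β) (A.smooth_A β)).congr (h β)

lemma IsChernWeilForm.inChart_eq {P : AdInvariantPolynomial G l} {A : Connection Q}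
    {θ : DiffForm E M (2 * l) ℂ} (h : IsChernWeilForm P A θ) (α : ι)
    {e : OpenPartialHomeomorph M E} (he : e ∈ atlas E M) {y : E} (hy : y ∈ chartSet e (Q.U α)) :
    θ.inChart e y = evalPow P (localCurv ((A.A α).inChart e) y) := by
  rw [← inChart_curvature (Q.isOpen_U α) (A.smooth_A α) he hy, ← inChart_evalForm,
    DiffForm.inChart, h.2 α _ hy.2]
  rfl

lemma IsChernWeilForm.d_eq_zero {P : AdInvariantPolynomial G l} {A : Connection Q}
    {θ : DiffForm E M (2 * l) ℂ} (h : IsChernWeilForm P A θ) : θ.d = 0 := by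
  funext x
  obtain ⟨α, hα⟩ := Q.cover x
  obtain ⟨e, he, y, hy, rfl⟩ := exists_chart_point E x hα
  refine DiffForm.eq_of_inChart_eq (θ' := 0) he hy.1 ?_
  have hS := isOpen_chartSet e (Q.isOpen_U α)
  rw [h.1.inChart_d isOpen_univ he ⟨hy.1, trivial⟩, Filter.EventuallyEq.extDeriv_eq (ω₂ := fun y =>
    evalPow P (localCurv ((A.A α).inChart e) y)), extDeriv_evalPow P hS (A.smooth_A α e he) hy]
  · rfl
  · filter_upwards [hS.mem_nhds hy] with z hz using h.inChart_eq α he hz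

/-- In a chart, `l` times the integral of `P(F_t, …, F_t, B)` over the segment of connections is a
smooth form, whose exterior derivative is the difference of the values of `P(F)` at the endpoints. -/
lemma exists_local_transgression (P : AdInvariantPolynomial G l) (A₀ A₁ : Connection Q) (α : ι)
    {e : OpenPartialHomeomorph M E} (he : e ∈ atlas E M) :
    ∃ ηe : E → E [⋀^Fin (2 * l - 1)]→L[ℝ] ℂ, ContDiffOn ℝ ∞ ηe (chartSet e (Q.U α)) ∧
      (∀ y ∈ chartSet e (Q.U α), ∀ v, ηe y v = (l : ℂ) * ∫ t in (0 : ℝ)..1,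
        (P.evalFormLast (curvature (A₀.A α + t • (A₁.A α - A₀.A α)))
          (A₁.A α - A₀.A α)).inChart e y v) ∧
      ∀ y ∈ chartSet e (Q.U α), ∀ v, ∀ h : 2 * l - 1 + 1 = 2 * l,
        extDeriv ηe y (fun m => v (finCongr h m)) =
          evalPow P (localCurv ((A₁.A α).inChart e) y) v -
            evalPow P (localCurv ((A₀.A α).inChart e) y) v := by
  have hS := isOpen_chartSet e (Q.isOpen_U α)
  set a := (A₀.A α).inChart e
  set b := (A₁.A α - A₀.A α).inChart e with hb_def
  have ha : ContDiffOn ℝ ∞ a (chartSet e (Q.U α)) := A₀.smooth_A α e he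
  have hb : ContDiffOn ℝ ∞ b (chartSet e (Q.U α)) :=
    ((A₁.smooth_A α).sub (A₀.smooth_A α)) e he
  obtain ⟨η, h1, h2, h3⟩ := (isPolyFamily_evalPowLast P hS ha hb).exists_integral hS
  refine ⟨(l : ℝ) • η, (h1.const_smul (l : ℝ)).congr fun _ _ => rfl, fun y hy v => ?_, fun y hy v h => ?_⟩
  · have hcurv : ∀ t : ℝ, (P.evalFormLast (curvature (A₀.A α + t • (A₁.A α - A₀.A α)))
        (A₁.A α - A₀.A α)).inChart e y = evalPowLast P (localCurv (a + t • b) y) (b y) := fun t => by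
      rw [inChart_evalFormLast, inChart_curvature (Q.isOpen_U α)
        ((A₀.smooth_A α).add (((A₁.smooth_A α).sub (A₀.smooth_A α)).const_smul t)) he hy,
        DiffForm.inChart_add, DiffForm.inChart_smul]
    simp only [hcurv]
    rw [Pi.smul_apply, ContinuousAlternatingMap.smul_apply, h2 y hy, Complex.real_smul,
      Complex.ofReal_natCast]
  · have hint := intervalIntegral.integral_eq_sub_of_hasDerivAt (a := 0) (b := 1)
      (f := fun t : ℝ => evalPow P (localCurv (a + t • b) y) v)
      (f' := fun t : ℝ => (l : ℝ) • extDeriv (fun y => evalPowLast P (localCurv (a + t • b) y) (b y)) y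
        fun m => v (finCongr h m))
      (fun t _ => hasDerivAt_evalPow_localCurv P h hS ha hb hy v t)
      (((h3 y hy _).1.const_smul (l : ℝ)).intervalIntegrable _ _)
    rw [intervalIntegral.integral_smul, ← (h3 y hy _).2] at hint
    have e1 : a + (1 : ℝ) • b = (A₁.A α).inChart e := by
      rw [one_smul, hb_def, DiffForm.inChart_sub]
      exact add_sub_cancel _ _
    have e0 : a + (0 : ℝ) • b = a := by rw [zero_smul, add_zero]
    simp only [e1, e0] at hint
    rw [extDeriv_smul, ContinuousAlternatingMap.smul_apply]
    exact hint

lemma exists_isTransgressionForm (P : AdInvariantPolynomial G l) (A₀ A₁ : Connection Q) :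
    ∃ η, IsTransgressionForm P A₀ A₁ η := by
  have hpt : ∀ x : M, ∃ a : TangentSpace 𝓘(ℝ, E) x [⋀^Fin (2 * l - 1)]→L[ℝ] ℂ,
      ∀ α, x ∈ Q.U α → ∀ v, a v = (l : ℂ) * ∫ t in (0 : ℝ)..1,
        P.evalFormLast (curvature (A₀.A α + t • (A₁.A α - A₀.A α))) (A₁.A α - A₀.A α) x v := by
    intro x
    obtain ⟨β, hβ⟩ := Q.cover x
    obtain ⟨e, he, y, hy, rfl⟩ := exists_chart_point E x hβ
    obtain ⟨ηe, -, h, -⟩ := exists_local_transgression P A₀ A₁ β he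
    obtain ⟨a, ha⟩ := DiffForm.exists_of_inChart he hy.1 (ηe y)
    refine ⟨a, fun α hα v => ?_⟩
    obtain ⟨w, rfl⟩ := DiffForm.exists_eq_mfderiv_symm he hy.1 v
    rw [ha, h y hy]
    simp only [evalFormLast_curvature_eq P A₀ A₁ _ hβ hα, DiffForm.inChart_apply]
  choose η hη using hpt
  refine ⟨η, ?_, fun α x hx v => hη x α hx v⟩
  refine DiffForm.smoothOn_univ_of_cover Q.isOpen_U Q.cover fun α e he => ?_
  obtain ⟨ηe, hsm, h, -⟩ := exists_local_transgression P A₀ A₁ α he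
  refine hsm.congr fun y hy => ?_
  ext v
  rw [h y hy, DiffForm.inChart_apply, hη _ α hy.2]
  rfl

/-- The transgression formula `P(F(A₁)) - P(F(A₀)) = dη`. -/
lemma IsTransgressionForm.sub_eq_d {P : AdInvariantPolynomial G l} {A₀ A₁ : Connection Q}
    {η : DiffForm E M (2 * l - 1) ℂ} (h : IsTransgressionForm P A₀ A₁ η)
    {θ₀ θ₁ : DiffForm E M (2 * l) ℂ} (h₀ : IsChernWeilForm P A₀ θ₀) (h₁ : IsChernWeilForm P A₁ θ₁)
    (hl : 2 * l - 1 + 1 = 2 * l) : θ₁ - θ₀ = DiffForm.castDegree hl η.d := by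
  funext x
  obtain ⟨α, hα⟩ := Q.cover x
  obtain ⟨e, he, y, hy, rfl⟩ := exists_chart_point E x hα
  refine DiffForm.eq_of_inChart_eq (θ := θ₁ - θ₀) he hy.1 ?_
  have hS := isOpen_chartSet e (Q.isOpen_U α)
  obtain ⟨ηe, -, hη, hd⟩ := exists_local_transgression P A₀ A₁ α he
  have hev : η.inChart e =ᶠ[𝓝 y] ηe := by
    filter_upwards [hS.mem_nhds hy] with z hz
    ext v
    rw [hη z hz, h.inChart_apply_eq hz]
  ext v
  have hcast : (DiffForm.castDegree hl η.d).inChart e y v =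
      η.d.inChart e y fun m => v (finCongr hl m) := rfl
  rw [hcast, h.1.inChart_d isOpen_univ he ⟨hy.1, trivial⟩, hev.extDeriv_eq, hd y hy,
    DiffForm.inChart_sub, Pi.sub_apply, ContinuousAlternatingMap.sub_apply,
    h₁.inChart_eq α he hy, h₀.inChart_eq α he hy]

end main

end ChernWeil

theorem mainTheorem5 {n : ℕ} {𝕜 : Type*} [RCLike 𝕜] (G : Subgroup (GL (Fin n) 𝕜))
    {E : Type*} [NormedAddCommGroup E] [NormedSpace ℝ E] [FiniteDimensional ℝ E]
    {M : Type*} [TopologicalSpace M] [ChartedSpace E M] [IsManifold 𝓘(ℝ, E) ∞ M]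
    {ι : Type*} (Q : ChernWeil.PrincipalBundle G E M ι)
    (l : ℕ) (P : ChernWeil.AdInvariantPolynomial G l) :
    (∀ A : ChernWeil.Connection Q, ∃! θ, ChernWeil.IsChernWeilForm P A θ) ∧
    (∀ (A : ChernWeil.Connection Q) (θ : ChernWeil.DiffForm E M (2 * l) ℂ),
      ChernWeil.IsChernWeilForm P A θ → θ.d = 0) ∧
    (∀ (A₀ A₁ : ChernWeil.Connection Q) (θ₀ θ₁ : ChernWeil.DiffForm E M (2 * l) ℂ),
      ChernWeil.IsChernWeilForm P A₀ θ₀ → ChernWeil.IsChernWeilForm P A₁ θ₁ →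
      (l = 0 → θ₁ = θ₀) ∧
      (∀ hl : 1 ≤ l, ∃ η : ChernWeil.DiffForm E M (2 * l - 1) ℂ,
        ChernWeil.IsTransgressionForm P A₀ A₁ η ∧
        θ₁ - θ₀ = ChernWeil.DiffForm.castDegree (by omega) η.d)) := by
  refine ⟨ChernWeil.existsUnique_isChernWeilForm P, fun A θ h => h.d_eq_zero,
    fun A₀ A₁ θ₀ θ₁ h₀ h₁ => ⟨h₀.eq_of_degree_zero h₁, fun hl => ?_⟩⟩
  obtain ⟨η, hη⟩ := ChernWeil.exists_isTransgressionForm P A₀ A₁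
  exact ⟨η, hη, hη.sub_eq_d h₀ h₁ _⟩
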